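/- Let $\mathscr V$ be a small monoidal category (small relative to a fixed universe $\mathrm{SET}$). A (left) $\mathscr V$-graded category $\mathscr C$ has a small set of objects; small sets $\mathscr C(X,A;B)$ of graded morphisms $f : X , A \to B$ ($X\in\mathscr V$; $A,B\in\mathscr C$), contravariantly functorial in $X$ (for $\alpha : X'\to X$, write $\alpha^*f : X',A\to B$ for the reindexing); composites $g\circ f : Y\otimes X , A \to C$ of $f:X,A\to B$ and $g:Y,B\to C$, natural in $X$ and $Y$; and identities $\mathsf i_A : I , A \to A$; these are associative and unital up to reindexing along the associators and unitors of $\mathscr V$. (Equivalently, $\mathscr C$ is a category enriched in $[\mathscr V^{\mathrm{op}},\mathrm{SET}]$ with Day convolution.) A graded functor is a map on objects and on graded morphisms of each grade that preserves reindexing, composition and identities; it is fully faithful if it is bijective on graded morphisms of each grade. A graded-natural transformation $\delta : F\Rightarrow G$ is a family $\delta_A : I , FA \to GA$ such that, for all $f : X , A\to B$, the reindexing of $\delta_B\circ Ff$ along $X\cong I\otimes X$ equals that of $Gf\circ\delta_A$ along $X\cong X\otimes I$. These form a 2-category $\mathscr V\text{-}\mathrm{GCAT}$. A copower of $A$ by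 $X\in\mathscr V$ is an object $X\cdot A$ with a graded morphism $\upsilon : X , A \to X\cdot A$ such that $f\mapsto f\circ\upsilon$ is a bijection $\mathscr C(Y,X\cdot A;B)\to\mathscr C(Y\otimes X,A;B)$ for all $Y\in\mathscr V$ and $B\in\mathscr C$; $\mathscr C$ has $\mathscr V$-copowers if all of these exist. Let $\mathscr V\text{-}\mathrm{GCAT}^{\cdot\mathrm{pres}}$ be the locally full sub-2-category of $\mathscr V\text{-}\mathrm{GCAT}$ on the $\mathscr V$-graded categories with $\mathscr V$-copowers and the graded functors that preserve $\mathscr V$-copowers. 1. The forgetful 2-functor $\mathscr V\text{-}\mathrm{GCAT}^{\cdot\mathrm{pres}}\to\mathscr V\text{-}\mathrm{GCAT}$ has a left biadjoint $\mathscr C\mapsto\mathscr C_\cdot$. That is, there are a pseudofunctor $\mathscr C\mapsto\mathscr C_\cdot$ and a pseudonatural unit with components graded functors $E:\mathscr C\to\mathscr C_\cdot$ such that, for every $\mathscr V$-graded category $\mathscr D$ with $\mathscr V$-copowers, the functor $$(-)\circ E : \mathscr V\text{-}\mathrm{GCAT}^{\cdot\mathrm{pres}}(\mathscr C_\cdot,\mathscr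 D)\to\mathscr V\text{-}\mathrm{GCAT}(\mathscr C,\mathscr D)$$ is an equivalence. Moreover, every $E$ is fully faithful and injective on objects, and every object of $\mathscr C_\cdot$ is a copower of some $EA$ ($A\in\mathscr C$) by some $X\in\mathscr V$. 2. Let $\mathscr V\text{-}\mathrm{ACT}^{\mathrm{strong}}$ be the 2-category of small left $\mathscr V$-actegories, strong morphisms and their 2-cells, and let $U:\mathscr V\text{-}\mathrm{ACT}^{\mathrm{strong}}\to\mathscr V\text{-}\mathrm{GCAT}$ be the canonical 2-functor that sends an actegory $\mathscr D$ to the $\mathscr V$-graded category with the same objects and $\mathscr D(X,A;B)=\mathscr D(X.A,B)$. Then $U$ has, in the same sense, a left biadjoint $\mathscr C\mapsto\mathscr V'\mathscr C$ (the enveloping actegory). The components $E:\mathscr C\to U(\mathscr V'\mathscr C)$ of its unit are fully faithful and injective on objects, and every object of $\mathscr V'\mathscr C$ is isomorphic to $X.EA$ for some $X\in\mathscr V$ and $A\in\mathscr C$. -/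

import Mathlib

open CategoryTheory MonoidalCategory

universe u

/-- A (left) `V`-graded category, for a monoidal category `V`. Elements of `Hom X A B` are the
graded morphisms `X , A ⟶ B` from `A` to `B` with grade `X`. Composition takes
`g : Y , B ⟶ C` and `f : X , A ⟶ B` to `g ∘ f : Y ⊗ X , A ⟶ C`. -/
structure GradedCat (V : Type u) [SmallCategory.{u} V] [MonoidalCategory V] : Type (u + 1) where
  Obj : Type u
  Hom : V → Obj → Obj → Type u
  reindex : ∀ {X Y : V} (_ : Y ⟶ X) {A B : Obj}, Hom X A B → Hom Y A B
  comp : ∀ {X Y : V} {A B C : Obj}, Hom Y B C → Hom X A B → Hom (Y ⊗ X) A C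
  iden : ∀ A : Obj, Hom (𝟙_ V) A A
  reindex_id : ∀ {X : V} {A B : Obj} (f : Hom X A B), reindex (𝟙 X) f = f
  reindex_reindex : ∀ {X Y Z : V} (α : Z ⟶ Y) (β : Y ⟶ X) {A B : Obj} (f : Hom X A B),
    reindex α (reindex β f) = reindex (α ≫ β) f
  comp_reindex : ∀ {X X' Y Y' : V} (β : Y' ⟶ Y) (α : X' ⟶ X) {A B C : Obj}
    (g : Hom Y B C) (f : Hom X A B),
    comp (reindex β g) (reindex α f) = reindex (β ⊗ₘ α) (comp g f)
  assoc : ∀ {X Y Z : V} {A B C D : Obj} (h : Hom Z C D) (g : Hom Y B C) (f : Hom X A B),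
    comp (comp h g) f = reindex (α_ Z Y X).hom (comp h (comp g f))
  comp_iden : ∀ {X : V} {A B : Obj} (f : Hom X A B), comp f (iden A) = reindex (ρ_ X).hom f
  iden_comp : ∀ {X : V} {A B : Obj} (f : Hom X A B), comp (iden B) f = reindex (λ_ X).hom f

namespace GradedCat

variable {V : Type u} [SmallCategory.{u} V] [MonoidalCategory V] (C : GradedCat V)

/-- Postcomposition of a graded morphism `f : X , A ⟶ B` with a morphism `p : B ⟶ B'` of the
underlying ordinary category (a graded morphism of grade `𝟙_ V`), reindexed along
`X ≅ 𝟙_ V ⊗ X` so as to have grade `X` again. -/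
def post {X : V} {A B B' : C.Obj} (p : C.Hom (𝟙_ V) B B') (f : C.Hom X A B) : C.Hom X A B' :=
  C.reindex (λ_ X).inv (C.comp p f)

/-- Precomposition of a graded morphism `f : X , A ⟶ B` with a morphism `p : A' ⟶ A` of the
underlying ordinary category, reindexed along `X ≅ X ⊗ 𝟙_ V`. -/
def pre {X : V} {A' A B : C.Obj} (f : C.Hom X A B) (p : C.Hom (𝟙_ V) A' A) : C.Hom X A' B :=
  C.reindex (ρ_ X).inv (C.comp f p)

variable {C}

theorem comp_reindex_left {X Y Y' : V} (β : Y' ⟶ Y) {A B B' : C.Obj}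
    (g : C.Hom Y B B') (f : C.Hom X A B) :
    C.comp (C.reindex β g) f = C.reindex (β ▷ X) (C.comp g f) := by
  conv_lhs => rw [← C.reindex_id f]
  rw [C.comp_reindex, tensorHom_id]

theorem comp_reindex_right {X X' Y : V} (α : X' ⟶ X) {A B B' : C.Obj}
    (g : C.Hom Y B B') (f : C.Hom X A B) :
    C.comp g (C.reindex α f) = C.reindex (Y ◁ α) (C.comp g f) := by
  conv_lhs => rw [← C.reindex_id g]
  rw [C.comp_reindex, id_tensorHom]

theorem pre_eq_post {A B B' : C.Obj} (q : C.Hom (𝟙_ V) B B') (p : C.Hom (𝟙_ V) A B) :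
    C.pre q p = C.post q p := by
  simp only [pre, post, unitors_inv_equal]

@[simp]
theorem post_iden {X : V} {A B : C.Obj} (f : C.Hom X A B) : C.post (C.iden B) f = f := by
  simp [post, C.iden_comp, C.reindex_reindex, C.reindex_id]

@[simp]
theorem pre_iden {X : V} {A B : C.Obj} (f : C.Hom X A B) : C.pre f (C.iden A) = f := by
  simp [pre, C.comp_iden, C.reindex_reindex, C.reindex_id]

@[simp]
theorem iden_pre {A B : C.Obj} (p : C.Hom (𝟙_ V) A B) : C.pre (C.iden B) p = p := by
  rw [pre_eq_post, post_iden]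

@[simp]
theorem post_self_iden {A B : C.Obj} (p : C.Hom (𝟙_ V) A B) : C.post p (C.iden A) = p := by
  rw [← pre_eq_post, pre_iden]

theorem post_post {X : V} {A B B' B'' : C.Obj} (q : C.Hom (𝟙_ V) B' B'')
    (p : C.Hom (𝟙_ V) B B') (f : C.Hom X A B) :
    C.post q (C.post p f) = C.post (C.post q p) f := by
  simp only [post, comp_reindex_left, comp_reindex_right, C.assoc, C.reindex_reindex]
  congr 1
  monoidal

theorem pre_pre {X : V} {A'' A' A B : C.Obj} (f : C.Hom X A B)
    (p : C.Hom (𝟙_ V) A' A) (q : C.Hom (𝟙_ V) A'' A') :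
    C.pre (C.pre f p) q = C.pre f (C.post p q) := by
  simp only [post, pre, comp_reindex_left, comp_reindex_right, C.assoc, C.reindex_reindex]
  congr 1
  monoidal

theorem post_pre {X : V} {A' A B B' : C.Obj} (q : C.Hom (𝟙_ V) B B') (f : C.Hom X A B)
    (p : C.Hom (𝟙_ V) A' A) : C.post q (C.pre f p) = C.pre (C.post q f) p := by
  simp only [post, pre, comp_reindex_left, comp_reindex_right, C.assoc, C.reindex_reindex]
  congr 1
  monoidal

/-- The graded morphism `υ : X , A ⟶ P` exhibits `P` as a copower of `A` by `X`. -/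
def IsCopower {X : V} {A P : C.Obj} (υ : C.Hom X A P) : Prop :=
  ∀ (B : C.Obj) (Y : V), Function.Bijective (fun f : C.Hom Y P B => C.comp f υ)

variable (C)

/-- `C` has `V`-copowers. -/
def HasCopowers : Prop :=
  ∀ (X : V) (A : C.Obj), ∃ (P : C.Obj) (υ : C.Hom X A P), IsCopower υ

end GradedCat

/-- A `V`-graded functor. -/
structure GradedFunctor {V : Type u} [SmallCategory.{u} V] [MonoidalCategory V]
    (C D : GradedCat V) : Type u where
  obj : C.Obj → D.Obj
  map : ∀ {X : V} {A B : C.Obj}, C.Hom X A B → D.Hom X (obj A) (obj B)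
  map_reindex : ∀ {X Y : V} (α : Y ⟶ X) {A B : C.Obj} (f : C.Hom X A B),
    map (C.reindex α f) = D.reindex α (map f)
  map_comp : ∀ {X Y : V} {A B B' : C.Obj} (g : C.Hom Y B B') (f : C.Hom X A B),
    map (C.comp g f) = D.comp (map g) (map f)
  map_iden : ∀ A : C.Obj, map (C.iden A) = D.iden (obj A)

namespace GradedFunctor

variable {V : Type u} [SmallCategory.{u} V] [MonoidalCategory V] {C D E : GradedCat V}

/-- The identity `V`-graded functor. -/
def id (C : GradedCat V) : GradedFunctor C C where
  obj A := A
  map f := f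
  map_reindex _ _ _ _ := rfl
  map_comp _ _ := rfl
  map_iden _ := rfl

/-- Composition of `V`-graded functors, in diagrammatic order. -/
def comp (F : GradedFunctor C D) (G : GradedFunctor D E) : GradedFunctor C E where
  obj A := G.obj (F.obj A)
  map f := G.map (F.map f)
  map_reindex α _ _ f := by rw [F.map_reindex, G.map_reindex]
  map_comp g f := by rw [F.map_comp, G.map_comp]
  map_iden A := by rw [F.map_iden, G.map_iden]

theorem map_post (F : GradedFunctor C D) {X : V} {A B B' : C.Obj} (p : C.Hom (𝟙_ V) B B')
    (f : C.Hom X A B) : F.map (C.post p f) = D.post (F.map p) (F.map f) := by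
  simp only [GradedCat.post, F.map_reindex, F.map_comp]

theorem map_pre (F : GradedFunctor C D) {X : V} {A' A B : C.Obj} (f : C.Hom X A B)
    (p : C.Hom (𝟙_ V) A' A) : F.map (C.pre f p) = D.pre (F.map f) (F.map p) := by
  simp only [GradedCat.pre, F.map_reindex, F.map_comp]

/-- `F` is fully faithful: it is bijective on graded morphisms of each grade. -/
def FullyFaithful (F : GradedFunctor C D) : Prop :=
  ∀ (X : V) (A B : C.Obj),
    Function.Bijective (F.map : C.Hom X A B → D.Hom X (F.obj A) (F.obj B))

/-- `F` preserves `V`-copowers. -/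
def PreservesCopowers (F : GradedFunctor C D) : Prop :=
  ∀ {X : V} {A P : C.Obj} (υ : C.Hom X A P), GradedCat.IsCopower υ →
    GradedCat.IsCopower (F.map υ)

end GradedFunctor

/-- A `V`-graded-natural transformation: a family of morphisms `F A ⟶ G A` in the underlying
ordinary category of `D` such that, for each `f : X , A ⟶ B` in `C`, the reindexing of
`app B ∘ F f` along `X ≅ 𝟙_ V ⊗ X` is the reindexing of `G f ∘ app A` along `X ≅ X ⊗ 𝟙_ V`. -/
@[ext]
structure GradedTrans {V : Type u} [SmallCategory.{u} V] [MonoidalCategory V]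
    {C D : GradedCat V} (F G : GradedFunctor C D) : Type u where
  app : ∀ A : C.Obj, D.Hom (𝟙_ V) (F.obj A) (G.obj A)
  naturality : ∀ {X : V} {A B : C.Obj} (f : C.Hom X A B),
    D.post (app B) (F.map f) = D.pre (G.map f) (app A)

namespace GradedTrans

variable {V : Type u} [SmallCategory.{u} V] [MonoidalCategory V] {C D E : GradedCat V}

/-- The identity transformation. -/
def id (F : GradedFunctor C D) : GradedTrans F F where
  app A := D.iden (F.obj A)
  naturality f := by simp

/-- Vertical composition: componentwise composition in the underlying ordinary category. -/
def vcomp {F G H : GradedFunctor C D} (σ : GradedTrans F G) (τ : GradedTrans G H) :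
    GradedTrans F H where
  app A := D.post (τ.app A) (σ.app A)
  naturality f := by
    rw [← GradedCat.post_post, σ.naturality, GradedCat.post_pre, τ.naturality,
      GradedCat.pre_pre]

/-- Left whiskering. -/
def whiskerLeft (F : GradedFunctor C D) {G H : GradedFunctor D E} (σ : GradedTrans G H) :
    GradedTrans (F.comp G) (F.comp H) where
  app A := σ.app (F.obj A)
  naturality f := σ.naturality (F.map f)

/-- Right whiskering. -/
def whiskerRight {F G : GradedFunctor C D} (σ : GradedTrans F G) (H : GradedFunctor D E) :
    GradedTrans (F.comp H) (G.comp H) where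
  app A := H.map (σ.app A)
  naturality f := by
    have h := congrArg (fun t => H.map t) (σ.naturality f)
    simp only [GradedFunctor.map_post, GradedFunctor.map_pre] at h
    exact h

end GradedTrans

section GradedBicategory

variable {V : Type u} [SmallCategory.{u} V] [MonoidalCategory V]

instance gradedFunctorCategory (C D : GradedCat V) : Category.{u} (GradedFunctor C D) where
  Hom F G := GradedTrans F G
  id F := GradedTrans.id F
  comp σ τ := σ.vcomp τ
  id_comp _ := GradedTrans.ext (funext fun _ => GradedCat.post_self_iden _)
  comp_id _ := GradedTrans.ext (funext fun _ => GradedCat.post_iden _)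
  assoc _ _ _ := GradedTrans.ext (funext fun _ => GradedCat.post_post _ _ _)

theorem graded_eq_id_comp_comp_id {C D : GradedCat V} {F G : GradedFunctor C D} (σ : F ⟶ G) :
    σ = 𝟙 F ≫ σ ≫ 𝟙 G := by
  rw [Category.id_comp, Category.comp_id]

/-- The 2-category of `V`-graded categories. -/
instance gradedBicategory : Bicategory.{u, u} (GradedCat V) where
  Hom C D := GradedFunctor C D
  id C := GradedFunctor.id C
  comp F G := F.comp G
  homCategory C D := gradedFunctorCategory C D
  whiskerLeft F _ _ σ := GradedTrans.whiskerLeft F σ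
  whiskerRight σ H := GradedTrans.whiskerRight σ H
  associator F G H := Iso.refl (F.comp (G.comp H))
  leftUnitor F := Iso.refl F
  rightUnitor F := Iso.refl F
  whiskerLeft_id _ _ := rfl
  whiskerLeft_comp _ _ _ _ _ _ := rfl
  id_whiskerLeft σ := graded_eq_id_comp_comp_id σ
  comp_whiskerLeft F G _ _ σ :=
    graded_eq_id_comp_comp_id (GradedTrans.whiskerLeft (F.comp G) σ)
  id_whiskerRight F G := GradedTrans.ext (funext fun A => G.map_iden (F.obj A))
  comp_whiskerRight σ τ H :=
    GradedTrans.ext (funext fun A => H.map_post (τ.app A) (σ.app A))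
  whiskerRight_id σ := graded_eq_id_comp_comp_id σ
  whiskerRight_comp σ G H :=
    graded_eq_id_comp_comp_id (GradedTrans.whiskerRight σ (G.comp H))
  whisker_assoc F _ _ σ H :=
    graded_eq_id_comp_comp_id (GradedTrans.whiskerLeft F (GradedTrans.whiskerRight σ H))
  whisker_exchange {_ _ E F G H K} σ τ := GradedTrans.ext (funext fun A => by
    have h := τ.naturality (σ.app A)
    rw [GradedCat.pre_eq_post] at h
    exact h.symm)
  pentagon {_ _ _ D E} F G H K := GradedTrans.ext (funext fun A => by
    change E.post (E.post (E.iden _) (E.iden _)) (K.map (D.iden _)) =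
      E.post (E.iden _) (E.iden _)
    rw [K.map_iden, GradedCat.post_iden, GradedCat.post_iden])
  triangle {_ D E} F G := GradedTrans.ext (funext fun A => by
    change E.post (E.iden _) (E.iden _) = G.map (D.iden _)
    rw [G.map_iden, GradedCat.post_iden])

end GradedBicategory

/-- A `V`-graded category with `V`-copowers. -/
structure CopowerGradedCat (V : Type u) [SmallCategory.{u} V] [MonoidalCategory V] :
    Type (u + 1) extends GradedCat V where
  hasCopowers : toGradedCat.HasCopowers

/-- A `V`-graded functor that preserves `V`-copowers. -/
structure CopowerFunctor {V : Type u} [SmallCategory.{u} V] [MonoidalCategory V]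
    (C D : CopowerGradedCat V) : Type u
    extends GradedFunctor C.toGradedCat D.toGradedCat where
  preservesCopowers : toGradedFunctor.PreservesCopowers

section CopowerBicategory

variable {V : Type u} [SmallCategory.{u} V] [MonoidalCategory V]

/-- The identity copower-preserving functor. -/
def CopowerFunctor.id (C : CopowerGradedCat V) : CopowerFunctor C C where
  toGradedFunctor := GradedFunctor.id C.toGradedCat
  preservesCopowers _ h := h

/-- Composition of copower-preserving functors. -/
def CopowerFunctor.comp {C D E : CopowerGradedCat V} (F : CopowerFunctor C D)
    (G : CopowerFunctor D E) : CopowerFunctor C E where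
  toGradedFunctor := F.toGradedFunctor.comp G.toGradedFunctor
  preservesCopowers _ h := G.preservesCopowers _ (F.preservesCopowers _ h)

instance copowerFunctorCategory (C D : CopowerGradedCat V) :
    Category.{u} (CopowerFunctor C D) where
  Hom F G := GradedTrans F.toGradedFunctor G.toGradedFunctor
  id F := GradedTrans.id F.toGradedFunctor
  comp σ τ := σ.vcomp τ
  id_comp σ := Category.id_comp (obj := GradedFunctor C.toGradedCat D.toGradedCat) σ
  comp_id σ := Category.comp_id (obj := GradedFunctor C.toGradedCat D.toGradedCat) σ
  assoc σ τ υ := Category.assoc (obj := GradedFunctor C.toGradedCat D.toGradedCat) σ τ υ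

/-- The locally full sub-2-category of `V`-graded categories given by those with `V`-copowers
and the functors that preserve them. -/
instance copowerBicategory : Bicategory.{u, u} (CopowerGradedCat V) where
  Hom C D := CopowerFunctor C D
  id C := CopowerFunctor.id C
  comp F G := F.comp G
  homCategory C D := copowerFunctorCategory C D
  whiskerLeft F _ _ σ := GradedTrans.whiskerLeft F.toGradedFunctor σ
  whiskerRight σ H := GradedTrans.whiskerRight σ H.toGradedFunctor
  associator F G H := Iso.refl (F.comp (G.comp H))
  leftUnitor F := Iso.refl F
  rightUnitor F := Iso.refl F
  whiskerLeft_id _ _ := rfl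
  whiskerLeft_comp _ _ _ _ _ _ := rfl
  id_whiskerLeft σ := Bicategory.id_whiskerLeft (B := GradedCat V) σ
  comp_whiskerLeft F G _ _ σ := Bicategory.comp_whiskerLeft (B := GradedCat V)
    F.toGradedFunctor G.toGradedFunctor σ
  id_whiskerRight F G := Bicategory.id_whiskerRight (B := GradedCat V)
    F.toGradedFunctor G.toGradedFunctor
  comp_whiskerRight σ τ H := Bicategory.comp_whiskerRight (B := GradedCat V)
    σ τ H.toGradedFunctor
  whiskerRight_id σ := Bicategory.whiskerRight_id (B := GradedCat V) σ
  whiskerRight_comp σ G H := Bicategory.whiskerRight_comp (B := GradedCat V)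
    σ G.toGradedFunctor H.toGradedFunctor
  whisker_assoc F _ _ σ H := Bicategory.whisker_assoc (B := GradedCat V)
    F.toGradedFunctor σ H.toGradedFunctor
  whisker_exchange σ τ := Bicategory.whisker_exchange (B := GradedCat V) σ τ
  pentagon F G H K := Bicategory.pentagon (B := GradedCat V)
    F.toGradedFunctor G.toGradedFunctor H.toGradedFunctor K.toGradedFunctor
  triangle F G := Bicategory.triangle (B := GradedCat V)
    F.toGradedFunctor G.toGradedFunctor

/-- The forgetful 2-functor from `V`-graded categories with `V`-copowers to `V`-graded
categories. -/
def forgetCopowers (V : Type u) [SmallCategory.{u} V] [MonoidalCategory V] :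
    Pseudofunctor (CopowerGradedCat V) (GradedCat V) where
  obj C := C.toGradedCat
  map F := CopowerFunctor.toGradedFunctor F
  map₂ σ := σ
  map₂_id _ := rfl
  map₂_comp _ _ := rfl
  mapId C := Iso.refl (GradedFunctor.id C.toGradedCat)
  mapComp F G := Iso.refl
    (F.toGradedFunctor.comp (CopowerFunctor.toGradedFunctor G))
  map₂_whisker_left F _ _ σ :=
    graded_eq_id_comp_comp_id (GradedTrans.whiskerLeft (CopowerFunctor.toGradedFunctor F) σ)
  map₂_whisker_right σ H :=
    graded_eq_id_comp_comp_id (GradedTrans.whiskerRight σ (CopowerFunctor.toGradedFunctor H))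
  map₂_associator {_ _ _ D} F G H := GradedTrans.ext (funext fun A => by
    change D.iden _ = D.post (D.post (D.post (D.post (D.iden _) (D.iden _)) (D.iden _))
      (GradedFunctor.map (CopowerFunctor.toGradedFunctor H) (GradedCat.iden _ _))) (D.iden _)
    rw [GradedFunctor.map_iden]
    simp only [GradedCat.post_iden])
  map₂_left_unitor {_ D} F := GradedTrans.ext (funext fun A => by
    change D.iden _ = D.post (D.post (D.iden _) (GradedFunctor.map (CopowerFunctor.toGradedFunctor F)
      (GradedCat.iden _ _))) (D.iden _)
    rw [GradedFunctor.map_iden]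
    simp only [GradedCat.post_iden])
  map₂_right_unitor {_ D} F := GradedTrans.ext (funext fun A => by
    change D.iden _ = D.post (D.post (D.iden _) (D.iden _)) (D.iden _)
    simp only [GradedCat.post_iden])

end CopowerBicategory

/-- A (small) left `V`-actegory: a small category with a coherent left action of `V`. -/
structure Actegory (V : Type u) [SmallCategory.{u} V] [MonoidalCategory V] : Type (u + 1) where
  carrier : Type u
  [cat : SmallCategory.{u} carrier]
  [act : MonoidalLeftAction V carrier]

attribute [instance] Actegory.cat Actegory.act

open MonoidalLeftAction Functor.LaxLeftLinear

/-- A strong morphism of left `V`-actegories: a functor with a coherent natural family of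
isomorphisms `X ⊙ₗ F A ⟶ F (X ⊙ₗ A)`. -/
structure StrongMorphism {V : Type u} [SmallCategory.{u} V] [MonoidalCategory V]
    (C D : Actegory V) : Type u where
  functor : C.carrier ⥤ D.carrier
  lax : functor.LaxLeftLinear V
  isIso : ∀ (X : V) (A : C.carrier), IsIso (μₗ functor X A)

attribute [instance] StrongMorphism.lax StrongMorphism.isIso

/-- A 2-cell between strong morphisms of actegories. -/
@[ext]
structure ActTrans {V : Type u} [SmallCategory.{u} V] [MonoidalCategory V]
    {C D : Actegory V} (F G : StrongMorphism C D) : Type u where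
  nat : F.functor ⟶ G.functor
  linear : ∀ (X : V) (A : C.carrier),
    X ⊴ₗ nat.app A ≫ μₗ G.functor X A = μₗ F.functor X A ≫ nat.app (X ⊙ₗ A)

theorem eq_id_comp_comp_id {𝒞 : Type*} [Category 𝒞] {F G : 𝒞} (σ : F ⟶ G) :
    σ = 𝟙 F ≫ σ ≫ 𝟙 G := by
  rw [Category.id_comp, Category.comp_id]

section ActBicategory

variable {V : Type u} [SmallCategory.{u} V] [MonoidalCategory V]

/-- The identity strong morphism. -/
def StrongMorphism.id (C : Actegory V) : StrongMorphism C C where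
  functor := 𝟭 C.carrier
  lax := { μₗ := fun X A => 𝟙 (X ⊙ₗ A) }
  isIso X A := (inferInstance : IsIso (𝟙 (X ⊙ₗ A)))

/-- Composition of strong morphisms. -/
def StrongMorphism.comp {C D E : Actegory V} (F : StrongMorphism C D)
    (G : StrongMorphism D E) : StrongMorphism C E where
  functor := F.functor ⋙ G.functor
  lax :=
    { μₗ := fun X A => μₗ G.functor X (F.functor.obj A) ≫ G.functor.map (μₗ F.functor X A)
      μₗ_naturality_left := fun f A => by
        simp only [Functor.comp_map, Functor.comp_obj, Category.assoc,
          μₗ_naturality_left_assoc, ← Functor.map_comp, μₗ_naturality_left]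
      μₗ_naturality_right := fun X _ _ f => by
        simp only [Functor.comp_map, Functor.comp_obj, Category.assoc,
          μₗ_naturality_right_assoc, ← Functor.map_comp, μₗ_naturality_right]
      μₗ_associativity := fun X Y A => by
        simp only [Functor.comp_map, Functor.comp_obj, Category.assoc, ← Functor.map_comp,
          μₗ_associativity]
        simp only [Functor.map_comp, μₗ_associativity_assoc, actionHomRight_comp,
          Category.assoc, μₗ_naturality_right_assoc]
      μₗ_unitality := fun A => by
        simp only [Functor.comp_map, Functor.comp_obj, Category.assoc, ← Functor.map_comp,
          ← μₗ_unitality] }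
  isIso X A := (inferInstance :
    IsIso (μₗ G.functor X (F.functor.obj A) ≫ G.functor.map (μₗ F.functor X A)))

namespace ActTrans

variable {C D E : Actegory V}

/-- The identity 2-cell. -/
def id (F : StrongMorphism C D) : ActTrans F F where
  nat := 𝟙 F.functor
  linear X A := by simp

/-- Vertical composition of 2-cells. -/
def vcomp {F G H : StrongMorphism C D} (σ : ActTrans F G) (τ : ActTrans G H) :
    ActTrans F H where
  nat := σ.nat ≫ τ.nat
  linear X A := by
    rw [NatTrans.comp_app, actionHomRight_comp, Category.assoc, τ.linear,
      reassoc_of% σ.linear X A, NatTrans.comp_app]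

/-- Left whiskering. -/
def whiskerLeft (F : StrongMorphism C D) {G H : StrongMorphism D E} (σ : ActTrans G H) :
    ActTrans (F.comp G) (F.comp H) where
  nat := Functor.whiskerLeft F.functor σ.nat
  linear X A := by
    change X ⊴ₗ σ.nat.app (F.functor.obj A) ≫
        μₗ H.functor X (F.functor.obj A) ≫ H.functor.map (μₗ F.functor X A) =
      (μₗ G.functor X (F.functor.obj A) ≫ G.functor.map (μₗ F.functor X A)) ≫
        σ.nat.app (F.functor.obj (X ⊙ₗ A))
    rw [reassoc_of% σ.linear, Category.assoc, σ.nat.naturality]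

/-- Right whiskering. -/
def whiskerRight {F G : StrongMorphism C D} (σ : ActTrans F G) (H : StrongMorphism D E) :
    ActTrans (F.comp H) (G.comp H) where
  nat := Functor.whiskerRight σ.nat H.functor
  linear X A := by
    change X ⊴ₗ H.functor.map (σ.nat.app A) ≫
        μₗ H.functor X (G.functor.obj A) ≫ H.functor.map (μₗ G.functor X A) =
      (μₗ H.functor X (F.functor.obj A) ≫ H.functor.map (μₗ F.functor X A)) ≫
        H.functor.map (σ.nat.app (X ⊙ₗ A))
    rw [μₗ_naturality_right_assoc, Category.assoc, ← H.functor.map_comp, σ.linear,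
      H.functor.map_comp]

end ActTrans

instance strongMorphismCategory (C D : Actegory V) : Category.{u} (StrongMorphism C D) where
  Hom F G := ActTrans F G
  id F := ActTrans.id F
  comp σ τ := σ.vcomp τ
  id_comp _ := ActTrans.ext (Category.id_comp _)
  comp_id _ := ActTrans.ext (Category.comp_id _)
  assoc _ _ _ := ActTrans.ext (Category.assoc _ _ _)

/-- The associator. -/
def actAssociator {C D E E' : Actegory V} (F : StrongMorphism C D) (G : StrongMorphism D E)
    (H : StrongMorphism E E') : (F.comp G).comp H ≅ F.comp (G.comp H) where
  hom :=
    { nat := (Functor.associator F.functor G.functor H.functor).hom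
      linear := fun X A => by
        change X ⊴ₗ 𝟙 _ ≫ ((μₗ H.functor X _ ≫ H.functor.map (μₗ G.functor X _)) ≫ H.functor.map (G.functor.map (μₗ F.functor X A))) =
          (μₗ H.functor X _ ≫ H.functor.map (μₗ G.functor X _ ≫ G.functor.map (μₗ F.functor X A))) ≫ 𝟙 _
        simp }
  inv :=
    { nat := (Functor.associator F.functor G.functor H.functor).inv
      linear := fun X A => by
        change X ⊴ₗ 𝟙 _ ≫ (μₗ H.functor X _ ≫ H.functor.map (μₗ G.functor X _ ≫ G.functor.map (μₗ F.functor X A))) =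
          ((μₗ H.functor X _ ≫ H.functor.map (μₗ G.functor X _)) ≫ H.functor.map (G.functor.map (μₗ F.functor X A))) ≫ 𝟙 _
        simp }
  hom_inv_id := ActTrans.ext (Iso.hom_inv_id _)
  inv_hom_id := ActTrans.ext (Iso.inv_hom_id _)

/-- The left unitor. -/
def actLeftUnitor {C D : Actegory V} (F : StrongMorphism C D) :
    (StrongMorphism.id C).comp F ≅ F where
  hom :=
    { nat := (Functor.leftUnitor F.functor).hom
      linear := fun X A => by
        change X ⊴ₗ 𝟙 _ ≫ μₗ F.functor X A =
          (μₗ F.functor X A ≫ F.functor.map (𝟙 (X ⊙ₗ A))) ≫ 𝟙 _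
        simp }
  inv :=
    { nat := (Functor.leftUnitor F.functor).inv
      linear := fun X A => by
        change X ⊴ₗ 𝟙 _ ≫ (μₗ F.functor X A ≫ F.functor.map (𝟙 (X ⊙ₗ A))) =
          (μₗ F.functor X A) ≫ 𝟙 _
        simp }
  hom_inv_id := ActTrans.ext (Iso.hom_inv_id _)
  inv_hom_id := ActTrans.ext (Iso.inv_hom_id _)

/-- The right unitor. -/
def actRightUnitor {C D : Actegory V} (F : StrongMorphism C D) :
    F.comp (StrongMorphism.id D) ≅ F where
  hom :=
    { nat := (Functor.rightUnitor F.functor).hom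
      linear := fun X A => by
        change X ⊴ₗ 𝟙 _ ≫ μₗ F.functor X A =
          (𝟙 _ ≫ μₗ F.functor X A) ≫ 𝟙 _
        simp }
  inv :=
    { nat := (Functor.rightUnitor F.functor).inv
      linear := fun X A => by
        change X ⊴ₗ 𝟙 _ ≫ (𝟙 _ ≫ μₗ F.functor X A) =
          (μₗ F.functor X A) ≫ 𝟙 _
        simp }
  hom_inv_id := ActTrans.ext (Iso.hom_inv_id _)
  inv_hom_id := ActTrans.ext (Iso.inv_hom_id _)

/-- The 2-category of left `V`-actegories and strong morphisms. -/
instance actBicategory : Bicategory.{u, u} (Actegory V) where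
  Hom C D := StrongMorphism C D
  id C := StrongMorphism.id C
  comp F G := F.comp G
  homCategory C D := strongMorphismCategory C D
  whiskerLeft F _ _ σ := ActTrans.whiskerLeft F σ
  whiskerRight σ H := ActTrans.whiskerRight σ H
  associator F G H := actAssociator F G H
  leftUnitor F := actLeftUnitor F
  rightUnitor F := actRightUnitor F
  whiskerLeft_id F G := ActTrans.ext (Functor.whiskerLeft_id' F.functor)
  whiskerLeft_comp F _ _ _ σ τ := ActTrans.ext
    (Functor.whiskerLeft_comp F.functor (ActTrans.nat σ) (ActTrans.nat τ))
  id_whiskerLeft σ := ActTrans.ext (NatTrans.ext (funext fun A =>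
    eq_id_comp_comp_id ((ActTrans.nat σ).app A)))
  comp_whiskerLeft F G _ _ σ := ActTrans.ext (NatTrans.ext (funext fun A =>
    eq_id_comp_comp_id ((ActTrans.nat σ).app (G.functor.obj (F.functor.obj A)))))
  id_whiskerRight F G := ActTrans.ext (NatTrans.ext (funext fun A =>
    G.functor.map_id (F.functor.obj A)))
  comp_whiskerRight σ τ H := ActTrans.ext (NatTrans.ext (funext fun A =>
    H.functor.map_comp ((ActTrans.nat σ).app A) ((ActTrans.nat τ).app A)))
  whiskerRight_id σ := ActTrans.ext (NatTrans.ext (funext fun A =>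
    eq_id_comp_comp_id ((ActTrans.nat σ).app A)))
  whiskerRight_comp σ G H := ActTrans.ext (NatTrans.ext (funext fun A =>
    eq_id_comp_comp_id (H.functor.map (G.functor.map ((ActTrans.nat σ).app A)))))
  whisker_assoc F _ _ σ H := ActTrans.ext (NatTrans.ext (funext fun A =>
    eq_id_comp_comp_id (H.functor.map ((ActTrans.nat σ).app (F.functor.obj A)))))
  whisker_exchange σ τ := ActTrans.ext (NatTrans.ext (funext fun A =>
    ((ActTrans.nat τ).naturality ((ActTrans.nat σ).app A)).symm))
  pentagon F G H K := ActTrans.ext (NatTrans.ext (funext fun A => by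
    change K.functor.map (𝟙 _) ≫ 𝟙 _ ≫ 𝟙 _ = 𝟙 _ ≫ 𝟙 _
    simp))
  triangle F G := ActTrans.ext (NatTrans.ext (funext fun A => by
    change 𝟙 _ ≫ 𝟙 _ = G.functor.map (𝟙 _)
    simp))

end ActBicategory

section Underlying

variable {V : Type u} [SmallCategory.{u} V] [MonoidalCategory V]

/-- A left `V`-actegory regarded as a `V`-graded category: a graded morphism `X , A ⟶ B` is a
morphism `X ⊙ₗ A ⟶ B`. -/
abbrev Actegory.toGraded (C : Actegory V) : GradedCat V where
  Obj := C.carrier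
  Hom X A B := X ⊙ₗ A ⟶ B
  reindex := fun {_ _} α {A _} f => α ⊵ₗ A ≫ f
  comp := fun {X Y A _ _} g f => (αₗ Y X A).hom ≫ Y ⊴ₗ f ≫ g
  iden A := (λₗ[V] A).hom
  reindex_id f := by simp
  reindex_reindex α β _ _ f := by simp
  comp_reindex := fun {X X' Y Y'} β α {A B D} g f => by
    simp only [MonoidalCategory.tensorHom_def, comp_actionHomLeft, whiskerLeft_actionHomLeft,
      whiskerRight_actionHomLeft, actionHomRight_comp, Category.assoc, Iso.inv_hom_id_assoc]
    rw [action_exchange_assoc, action_exchange_assoc]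
  assoc h g f := by
    simp only [tensor_actionHomRight, actionHomRight_comp, Category.assoc,
      Iso.inv_hom_id_assoc, associator_actionHom_assoc]
  comp_iden f := by simp
  iden_comp f := by simp

theorem Actegory.post_eq (C : Actegory V) {X : V} {A B B' : C.carrier} (f : X ⊙ₗ A ⟶ B)
    (p : 𝟙_ V ⊙ₗ B ⟶ B') :
    C.toGraded.post p f = f ≫ (λₗ B).inv ≫ p := by
  have h : (λ_ X).inv ⊵ₗ A = (λₗ (X ⊙ₗ A)).inv ≫ (αₗ (𝟙_ V) X A).inv := by
    rw [← cancel_mono ((λ_ X).hom ⊵ₗ A), inv_hom_actionHomLeft, leftUnitor_actionHom]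
    simp
  change (λ_ X).inv ⊵ₗ A ≫ (αₗ (𝟙_ V) X A).hom ≫ 𝟙_ V ⊴ₗ f ≫ p = _
  rw [h, unit_actionHomRight]
  simp

theorem Actegory.pre_eq (C : Actegory V) {X : V} {A' A B : C.carrier} (f : X ⊙ₗ A ⟶ B)
    (p : 𝟙_ V ⊙ₗ A' ⟶ A) :
    C.toGraded.pre f p = X ⊴ₗ ((λₗ A').inv ≫ p) ≫ f := by
  have h : (ρ_ X).inv ⊵ₗ A' = X ⊴ₗ (λₗ A').inv ≫ (αₗ X (𝟙_ V) A').inv := by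
    rw [← cancel_mono ((ρ_ X).hom ⊵ₗ A'), inv_hom_actionHomLeft, rightUnitor_actionHom]
    simp
  change (ρ_ X).inv ⊵ₗ A' ≫ (αₗ X (𝟙_ V) A').hom ≫ X ⊴ₗ p ≫ f = _
  rw [h]
  simp

/-- A strong morphism of actegories regarded as a `V`-graded functor: it sends
`f : X ⊙ₗ A ⟶ B` to `X ⊙ₗ F A ⟶ F (X ⊙ₗ A) ⟶ F B`. -/
abbrev StrongMorphism.toGraded {C D : Actegory V} (F : StrongMorphism C D) :
    GradedFunctor C.toGraded D.toGraded where
  obj A := F.functor.obj A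
  map := fun {X A _} f => μₗ F.functor X A ≫ F.functor.map f
  map_reindex α _ _ f := by
    simp only [Functor.map_comp, μₗ_naturality_left_assoc]
  map_comp g f := by
    simp only [Functor.map_comp, μₗ_associativity_assoc, actionHomRight_comp,
      Category.assoc, μₗ_naturality_right_assoc]
  map_iden A := (μₗ_unitality F.functor A).symm

/-- A 2-cell of actegories regarded as a `V`-graded-natural transformation. -/
abbrev ActTrans.toGraded {C D : Actegory V} {F G : StrongMorphism C D} (σ : ActTrans F G) :
    GradedTrans F.toGraded G.toGraded where
  app A := (λₗ[V] (F.functor.obj A)).hom ≫ σ.nat.app A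
  naturality {X A B} f := by
    rw [Actegory.post_eq, Actegory.pre_eq]
    simp only [Iso.inv_hom_id_assoc, Category.assoc]
    rw [reassoc_of% σ.linear X A, σ.nat.naturality]

variable (V)

/-- The canonical 2-functor from left `V`-actegories and strong morphisms to `V`-graded
categories. -/
def actToGraded : Pseudofunctor (Actegory V) (GradedCat V) where
  obj C := C.toGraded
  map F := StrongMorphism.toGraded F
  map₂ σ := ActTrans.toGraded σ
  map₂_id {C D} F := GradedTrans.ext (funext fun A => Category.comp_id _)
  map₂_comp {C D F G H} σ τ := GradedTrans.ext (funext fun A => by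
    change (λₗ[V] _).hom ≫ (ActTrans.nat σ).app A ≫ (ActTrans.nat τ).app A =
      D.toGraded.post ((λₗ[V] _).hom ≫ (ActTrans.nat τ).app A)
        ((λₗ[V] _).hom ≫ (ActTrans.nat σ).app A)
    rw [Actegory.post_eq]
    simp)
  mapId C :=
    { hom :=
        { app := fun A => C.toGraded.iden A
          naturality := fun {X A B} f => by
            change C.toGraded.post (C.toGraded.iden B) (𝟙 _ ≫ f) =
              C.toGraded.pre f (C.toGraded.iden A)
            rw [GradedCat.post_iden, GradedCat.pre_iden, Category.id_comp] }
      inv :=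
        { app := fun A => C.toGraded.iden A
          naturality := fun {X A B} f => by
            change C.toGraded.post (C.toGraded.iden B) f =
              C.toGraded.pre (𝟙 _ ≫ f) (C.toGraded.iden A)
            rw [GradedCat.post_iden, GradedCat.pre_iden, Category.id_comp] }
      hom_inv_id := GradedTrans.ext (funext fun A =>
        GradedCat.post_iden (C := C.toGraded) (C.toGraded.iden A))
      inv_hom_id := GradedTrans.ext (funext fun A =>
        GradedCat.post_iden (C := C.toGraded) (C.toGraded.iden A)) }
  mapComp {_ _ D} F G :=
    { hom :=
        { app := fun A => D.toGraded.iden (G.functor.obj (F.functor.obj A))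
          naturality := fun {X A B} f => by
            refine (GradedCat.post_iden _).trans (Eq.trans ?_ (GradedCat.pre_iden _).symm)
            change (μₗ G.functor X (F.functor.obj A) ≫ G.functor.map (μₗ F.functor X A)) ≫
                G.functor.map (F.functor.map f) =
              μₗ G.functor X (F.functor.obj A) ≫
                G.functor.map (μₗ F.functor X A ≫ F.functor.map f)
            rw [Functor.map_comp, Category.assoc] }
      inv :=
        { app := fun A => D.toGraded.iden (G.functor.obj (F.functor.obj A))
          naturality := fun {X A B} f => by
            refine (GradedCat.post_iden _).trans (Eq.trans ?_ (GradedCat.pre_iden _).symm)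
            change μₗ G.functor X (F.functor.obj A) ≫
                G.functor.map (μₗ F.functor X A ≫ F.functor.map f) =
              (μₗ G.functor X (F.functor.obj A) ≫ G.functor.map (μₗ F.functor X A)) ≫
                G.functor.map (F.functor.map f)
            rw [Functor.map_comp, Category.assoc] }
      hom_inv_id := GradedTrans.ext (funext fun A =>
        GradedCat.post_iden (C := D.toGraded) (D.toGraded.iden _))
      inv_hom_id := GradedTrans.ext (funext fun A =>
        GradedCat.post_iden (C := D.toGraded) (D.toGraded.iden _)) }
  map₂_whisker_left {_ _ D} F G H σ := GradedTrans.ext (funext fun A => by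
    change (λₗ[V] _).hom ≫ (ActTrans.nat σ).app (F.functor.obj A) =
      D.toGraded.post (D.toGraded.post (D.toGraded.iden _)
        ((λₗ[V] _).hom ≫ (ActTrans.nat σ).app (F.functor.obj A))) (D.toGraded.iden _)
    rw [GradedCat.post_iden, GradedCat.post_self_iden])
  map₂_whisker_right {_ _ D F G} σ H := GradedTrans.ext (funext fun A => by
    change (λₗ[V] _).hom ≫ H.functor.map ((ActTrans.nat σ).app A) =
      D.toGraded.post (D.toGraded.post (D.toGraded.iden _)
        (μₗ H.functor (𝟙_ V) (F.functor.obj A) ≫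
          H.functor.map ((λₗ[V] (F.functor.obj A)).hom ≫ (ActTrans.nat σ).app A)))
        (D.toGraded.iden _)
    rw [GradedCat.post_iden, GradedCat.post_self_iden, Functor.map_comp, μₗ_unitality,
      Category.assoc])
  map₂_associator {_ _ C D} F G H := GradedTrans.ext (funext fun A => by
    change (λₗ[V] _).hom ≫ 𝟙 _ = D.toGraded.post (D.toGraded.post (D.toGraded.post
      (D.toGraded.post (D.toGraded.iden _) (D.toGraded.iden _)) (D.toGraded.iden _))
      ((StrongMorphism.toGraded H).map (C.toGraded.iden (G.functor.obj (F.functor.obj A)))))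
      (D.toGraded.iden _)
    rw [GradedFunctor.map_iden]
    rw [GradedCat.post_iden, GradedCat.post_iden, GradedCat.post_iden, GradedCat.post_iden,
      Category.comp_id])
  map₂_left_unitor {C D} F := GradedTrans.ext (funext fun A => by
    change (λₗ[V] _).hom ≫ 𝟙 _ = D.toGraded.post (D.toGraded.post (D.toGraded.iden _)
      ((StrongMorphism.toGraded F).map (C.toGraded.iden A))) (D.toGraded.iden _)
    rw [GradedFunctor.map_iden]
    rw [GradedCat.post_iden, GradedCat.post_iden, Category.comp_id])
  map₂_right_unitor {_ D} F := GradedTrans.ext (funext fun A => by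
    change (λₗ[V] _).hom ≫ 𝟙 _ = D.toGraded.post (D.toGraded.post (D.toGraded.iden _)
      (D.toGraded.iden _)) (D.toGraded.iden _)
    rw [GradedCat.post_iden, GradedCat.post_iden, Category.comp_id])

end Underlying

/-- A left biadjoint of a pseudofunctor `U : 𝓑 ⥤ 𝓒`, presented by its unit: a pseudofunctor `L`
and a pseudonatural transformation `1 ⟶ U L` such that, for all `c : 𝓒` and `b : 𝓑`, the functor
`𝓑(L c, b) ⥤ 𝓒(c, U b)`, `G ↦ unit_c ≫ U G` (pseudonatural in `c` and `b`) is an equivalence. -/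
structure LeftBiadjoint {𝓑 𝓒 : Type*} [Bicategory 𝓑] [Bicategory 𝓒]
    (U : Pseudofunctor 𝓑 𝓒) where
  L : Pseudofunctor 𝓒 𝓑
  unit : Pseudofunctor.StrongTrans (Pseudofunctor.id 𝓒) (L.comp U)
  isEquivalence : ∀ (c : 𝓒) (b : 𝓑),
    (U.mapFunctor (L.obj c) b ⋙ Bicategory.precomp (U.obj b) (unit.app c)).IsEquivalence

/-! One construction serves both biadjunctions. The objects of the enveloping actegory are formal
copowers `X · A`. In a completion freely generated by copowers, `Y · B` receives from `A` the Day
convolution of the representable at `Y` with `C(-, A; B)`, and a morphism out of `X · A` is a graded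
morphism `X , A ⟶ Y · B`. This forces the hom-set `X · A ⟶ Y · B` to be the coend over `W` of `V(X,
Y ⊗ W) × C(W, A; B)`. Since `V` acts on the left of `Y` and `W` stands on its right, `Z · (X · A) =
(Z ⊗ X) · A` is an action whose coherence is that of `V`. At `Y = I` the coend collapses by the
co-Yoneda lemma, so `A ↦ I · A` is fully faithful.

In the graded category of an actegory, a copower is the same as an invertible `X ⊙ₗ A ⟶ P`
(`Actegory.isCopower_iff_isIso`). So every actegory has copowers, and strong morphisms amount to
copower-preserving graded functors. The free completion under copowers can therefore be taken to be
the enveloping actegory, seen as a graded category.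

The universal property rests on `EnvObj.homMk_comp_copowerHom`: the class `p` of `(f, g)` satisfies
`p ∘ υ = f^*(υ' ∘ E g)`, where `υ` and `υ'` are the canonical copower morphisms. A
copower-preserving functor is thus determined by its values on `E` and on these morphisms, and
transformations out of it are determined by their components at the objects `E A`. Conversely, a
graded functor `F` into a category with copowers extends by choosing copowers of the objects `F A`
and using the same equation as the definition on morphisms. -/

section Enveloping

/-! ### Formal copowers: the coend of morphisms and the action of `V`. -/

variable {V : Type u} [SmallCategory.{u} V] [MonoidalCategory V]

/-- The objects of the enveloping actegory of `C`: formal copowers `grade · base`. -/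
@[ext]
structure EnvObj (C : GradedCat V) : Type u where
  grade : V
  base : C.Obj

/-- Representatives of morphisms `X · A ⟶ Y · B` of the enveloping actegory. -/
structure EnvPreHom {C : GradedCat V} (P Q : EnvObj C) : Type u where
  mid : V
  left : P.grade ⟶ Q.grade ⊗ mid
  right : C.Hom mid P.base Q.base

/-- The relation that identifies representatives which differ by sliding a morphism of `V`
through the middle grade. -/
inductive EnvRel {C : GradedCat V} {P Q : EnvObj C} : EnvPreHom P Q → EnvPreHom P Q → Prop
  | slide {W W' : V} (f : P.grade ⟶ Q.grade ⊗ W) (α : W ⟶ W') (g : C.Hom W' P.base Q.base) :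
    EnvRel ⟨W, f, C.reindex α g⟩ ⟨W', f ≫ Q.grade ◁ α, g⟩

/-- Morphisms `X · A ⟶ Y · B` of the enveloping actegory: the coend over `W` of
`V(X, Y ⊗ W) × C(W, A; B)`. -/
def EnvHom {C : GradedCat V} (P Q : EnvObj C) : Type u :=
  Quot (EnvRel (P := P) (Q := Q))

namespace EnvHom

variable {C : GradedCat V}

/-- The class of a representative. -/
def mk {P Q : EnvObj C} {W : V} (f : P.grade ⟶ Q.grade ⊗ W) (g : C.Hom W P.base Q.base) :
    EnvHom P Q :=
  Quot.mk _ ⟨W, f, g⟩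

theorem mk_slide {P Q : EnvObj C} {W W' : V} (f : P.grade ⟶ Q.grade ⊗ W) (α : W ⟶ W')
    (g : C.Hom W' P.base Q.base) : mk f (C.reindex α g) = mk (f ≫ Q.grade ◁ α) g :=
  Quot.sound (EnvRel.slide f α g)

theorem ind {P Q : EnvObj C} {motive : EnvHom P Q → Prop}
    (h : ∀ {W : V} (f : P.grade ⟶ Q.grade ⊗ W) (g : C.Hom W P.base Q.base), motive (mk f g))
    (p : EnvHom P Q) : motive p :=
  Quot.ind (fun r => h r.left r.right) p

/-- Maps out of the morphisms of the enveloping actegory. -/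
def lift {P Q : EnvObj C} {T : Type*}
    (t : ∀ {W : V} (_ : P.grade ⟶ Q.grade ⊗ W) (_ : C.Hom W P.base Q.base), T)
    (ht : ∀ {W W' : V} (f : P.grade ⟶ Q.grade ⊗ W) (α : W ⟶ W') (g : C.Hom W' P.base Q.base),
      t f (C.reindex α g) = t (f ≫ Q.grade ◁ α) g) (p : EnvHom P Q) : T :=
  Quot.lift (fun r => t r.left r.right) (fun _ _ h => by cases h; exact ht _ _ _) p

/-- Composition in the enveloping actegory. -/
def comp {P Q R : EnvObj C} (p : EnvHom P Q) (q : EnvHom Q R) : EnvHom P R :=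
  -- The factors `W' ⊗ W` appear in this order because that is the grade of `g' ∘ g`.
  p.lift (fun {W} f g => q.lift
      (fun {W'} f' g' => mk (f ≫ f' ▷ W ≫ (α_ R.grade W' W).hom) (C.comp g' g))
      (fun f' α g' => by
        rw [GradedCat.comp_reindex_left, mk_slide]
        congr 1
        simp))
    (fun {W W'} f α g => by
      induction q using ind with | h f' g' => ?_
      change mk _ _ = mk _ _
      rw [GradedCat.comp_reindex_right, mk_slide]
      congr 1
      -- Sliding in the first factor moves `α` past `f' ▷ W`, which is the interchange law in `V`.
      simp [whisker_exchange_assoc])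

end EnvHom

instance envCategory (C : GradedCat V) : SmallCategory.{u} (EnvObj C) where
  Hom P Q := EnvHom P Q
  id P := EnvHom.mk (ρ_ P.grade).inv (C.iden P.base)
  comp p q := p.comp q
  id_comp {P Q} p := by
    induction p using EnvHom.ind with | h f g => ?_
    change EnvHom.mk _ _ = EnvHom.mk _ _
    -- The laws of `C` hold up to reindexing along a structural isomorphism. Sliding moves it into
    -- the `V`-component, where a coherence equation remains. The other category laws follow in the
    -- same way.
    rw [C.comp_iden, EnvHom.mk_slide]
    congr 1
    simp
  comp_id {P Q} p := by
    induction p using EnvHom.ind with | h f g => ?_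
    change EnvHom.mk _ _ = EnvHom.mk _ _
    rw [C.iden_comp, EnvHom.mk_slide]
    congr 1
    simp
  assoc {P Q R S} p q r := by
    induction p using EnvHom.ind with | h f g => ?_
    induction q using EnvHom.ind with | h f' g' => ?_
    induction r using EnvHom.ind with | h f'' g'' => ?_
    change EnvHom.mk _ _ = EnvHom.mk _ _
    rw [C.assoc, EnvHom.mk_slide]
    congr 1
    simp

namespace EnvObj

variable {C : GradedCat V}

/-- The morphism of the enveloping actegory with a given representative. -/
def homMk {P Q : EnvObj C} {W : V} (f : P.grade ⟶ Q.grade ⊗ W) (g : C.Hom W P.base Q.base) :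
    P ⟶ Q :=
  EnvHom.mk f g

theorem homMk_slide {P Q : EnvObj C} {W W' : V} (f : P.grade ⟶ Q.grade ⊗ W) (α : W ⟶ W')
    (g : C.Hom W' P.base Q.base) : homMk f (C.reindex α g) = homMk (f ≫ Q.grade ◁ α) g :=
  EnvHom.mk_slide f α g

theorem hom_ind {P Q : EnvObj C} {motive : (P ⟶ Q) → Prop}
    (h : ∀ {W : V} (f : P.grade ⟶ Q.grade ⊗ W) (g : C.Hom W P.base Q.base),
      motive (homMk f g)) (p : P ⟶ Q) : motive p :=
  EnvHom.ind h p

theorem homMk_comp {P Q R : EnvObj C} {W W' : V} (f : P.grade ⟶ Q.grade ⊗ W)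
    (g : C.Hom W P.base Q.base) (f' : Q.grade ⟶ R.grade ⊗ W') (g' : C.Hom W' Q.base R.base) :
    homMk f g ≫ homMk f' g' = homMk (f ≫ f' ▷ W ≫ (α_ R.grade W' W).hom) (C.comp g' g) :=
  rfl

/-- The morphism `X · A ⟶ Y · A` induced by a morphism `X ⟶ Y` of `V`. -/
def ofGrade (A : C.Obj) {X Y : V} (φ : X ⟶ Y) : (⟨X, A⟩ : EnvObj C) ⟶ ⟨Y, A⟩ :=
  homMk (P := ⟨X, A⟩) (Q := ⟨Y, A⟩) (φ ≫ (ρ_ Y).inv) (C.iden A)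

@[simp]
theorem ofGrade_id (A : C.Obj) (X : V) : ofGrade A (𝟙 X) = 𝟙 (⟨X, A⟩ : EnvObj C) := by
  simp only [ofGrade, Category.id_comp]
  rfl

@[simp]
-- The identity of `C` in `ofGrade` contributes only a unit factor, which slides away; hence
-- morphisms coming from `V` act on the first component of a representative alone.
theorem ofGrade_comp_homMk {A : C.Obj} {X Y : V} {Q : EnvObj C} {W : V} (φ : X ⟶ Y)
    (f : Y ⟶ Q.grade ⊗ W) (g : C.Hom W A Q.base) :
    ofGrade A φ ≫ homMk (P := ⟨Y, A⟩) f g = homMk (P := ⟨X, A⟩) (φ ≫ f) g := by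
  rw [ofGrade, homMk_comp, C.comp_iden, homMk_slide]
  congr 1
  simp

@[simp]
theorem homMk_comp_ofGrade {P : EnvObj C} {B : C.Obj} {X Y : V} {W : V}
    (f : P.grade ⟶ X ⊗ W) (g : C.Hom W P.base B) (φ : X ⟶ Y) :
    homMk (Q := ⟨X, B⟩) f g ≫ ofGrade B φ = homMk (Q := ⟨Y, B⟩) (f ≫ φ ▷ W) g := by
  rw [ofGrade, homMk_comp, C.iden_comp, homMk_slide]
  congr 1
  simp

@[simp]
theorem ofGrade_comp (A : C.Obj) {X Y Z : V} (φ : X ⟶ Y) (ψ : Y ⟶ Z) :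
    ofGrade A φ ≫ ofGrade A ψ = ofGrade A (φ ≫ ψ) := by
  rw [show ofGrade A ψ = homMk (P := ⟨Y, A⟩) (Q := ⟨Z, A⟩) (ψ ≫ (ρ_ Z).inv) (C.iden A) from rfl,
    ofGrade_comp_homMk, ofGrade, Category.assoc]

@[simp]
theorem ofGrade_comp_assoc (A : C.Obj) {X Y Z : V} (φ : X ⟶ Y) (ψ : Y ⟶ Z) {Q : EnvObj C}
    (p : (⟨Z, A⟩ : EnvObj C) ⟶ Q) :
    ofGrade A φ ≫ ofGrade A ψ ≫ p = ofGrade A (φ ≫ ψ) ≫ p := by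
  rw [← Category.assoc, ofGrade_comp]

/-- The isomorphism `X · A ≅ Y · A` induced by an isomorphism `X ≅ Y` of `V`. -/
@[simps]
def isoOfGrade (A : C.Obj) {X Y : V} (φ : X ≅ Y) : (⟨X, A⟩ : EnvObj C) ≅ ⟨Y, A⟩ where
  hom := ofGrade A φ.hom
  inv := ofGrade A φ.inv

/-- The action of an object of `V` on a morphism of the enveloping actegory. -/
def whisker (Z : V) {P Q : EnvObj C} (p : P ⟶ Q) :
    (⟨Z ⊗ P.grade, P.base⟩ : EnvObj C) ⟶ ⟨Z ⊗ Q.grade, Q.base⟩ :=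
  EnvHom.lift (P := P) (Q := Q)
    (fun {W} f g => homMk (P := ⟨Z ⊗ P.grade, P.base⟩) (Q := ⟨Z ⊗ Q.grade, Q.base⟩)
      (Z ◁ f ≫ (α_ Z Q.grade W).inv) g)
    (fun f α g => by
      rw [homMk_slide]
      congr 1
      simp) p

@[simp]
theorem whisker_homMk (Z : V) {P Q : EnvObj C} {W : V} (f : P.grade ⟶ Q.grade ⊗ W)
    (g : C.Hom W P.base Q.base) : whisker Z (homMk f g) =
      homMk (P := ⟨Z ⊗ P.grade, P.base⟩) (Q := ⟨Z ⊗ Q.grade, Q.base⟩)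
        (Z ◁ f ≫ (α_ Z Q.grade W).inv) g :=
  rfl

@[simp]
theorem whisker_ofGrade (Z : V) (A : C.Obj) {X Y : V} (φ : X ⟶ Y) :
    whisker Z (ofGrade A φ) = ofGrade A (Z ◁ φ) := by
  rw [ofGrade, whisker_homMk, ofGrade]
  congr 1
  simp

@[simp]
theorem whisker_id (Z : V) (P : EnvObj C) : whisker Z (𝟙 P) = 𝟙 _ := by
  rw [← ofGrade_id, whisker_ofGrade, whiskerLeft_id, ofGrade_id]

@[simp]
theorem whisker_comp (Z : V) {P Q R : EnvObj C} (p : P ⟶ Q) (q : Q ⟶ R) :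
    whisker Z (p ≫ q) = whisker Z p ≫ whisker Z q := by
  induction p using hom_ind with | h f g => ?_
  induction q using hom_ind with | h f' g' => ?_
  simp only [whisker_homMk, homMk_comp]
  congr 1
  simp

/-- The action changes a grade on its left, while a representative adds `W` on its right, so the two
operations commute. Bifunctoriality of the action rests on this. -/
theorem ofGrade_whisker_exchange {Z Z' : V} (φ : Z ⟶ Z') {P Q : EnvObj C} (p : P ⟶ Q) :
    ofGrade P.base (φ ▷ P.grade) ≫ whisker Z' p =
      whisker Z p ≫ ofGrade Q.base (φ ▷ Q.grade) := by
  induction p using hom_ind with | h f g => ?_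
  simp only [whisker_homMk, ofGrade_comp_homMk, homMk_comp_ofGrade, ← whisker_exchange_assoc]
  simp

theorem associator_whisker (Y Z : V) {P Q : EnvObj C} (p : P ⟶ Q) :
    ofGrade P.base (α_ Y Z P.grade).hom ≫ whisker Y (whisker Z p) =
      whisker (Y ⊗ Z) p ≫ ofGrade Q.base (α_ Y Z Q.grade).hom := by
  induction p using hom_ind with | h f g => ?_
  simp

theorem leftUnitor_whisker {P Q : EnvObj C} (p : P ⟶ Q) :
    ofGrade P.base (λ_ P.grade).hom ≫ p =
      whisker (𝟙_ V) p ≫ ofGrade Q.base (λ_ Q.grade).hom := by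
  induction p using hom_ind with | h f g => ?_
  obtain ⟨X, A⟩ := P
  obtain ⟨Y, B⟩ := Q
  simp

/-- The action only tensors the grade, so its structure isomorphisms come from those of `V` through
`ofGrade`, and its coherence axioms are images of coherence equations in `V`. -/
instance leftAction (C : GradedCat V) : MonoidalLeftAction V (EnvObj C) where
  actionObj Z P := ⟨Z ⊗ P.grade, P.base⟩
  actionHomLeft φ P := ofGrade P.base (φ ▷ P.grade)
  actionHomRight Z _ _ p := whisker Z p
  actionAssocIso Y Z P := isoOfGrade P.base (α_ Y Z P.grade)
  actionUnitIso P := isoOfGrade P.base (λ_ P.grade)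
  actionHom_def _ _ := rfl
  actionHomRight_id := whisker_id
  id_actionHomLeft Z P := by simp
  actionHom_comp f₁ f₂ g₁ g₂ := by
    simp only [comp_whiskerRight, ← ofGrade_comp, whisker_comp, Category.assoc]
    rw [← Category.assoc (ofGrade _ (f₂ ▷ _)), ofGrade_whisker_exchange, Category.assoc]
  actionAssocIso_hom_naturality f g h := by
    simp only [isoOfGrade_hom, Category.assoc, ← associator_whisker, whisker_comp,
      whisker_ofGrade, ofGrade_comp_assoc]
    congr 2
    simp [MonoidalCategory.tensorHom_def]
  actionUnitIso_hom_naturality := leftUnitor_whisker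
  whiskerLeft_actionHomLeft Z _ _ φ P := by simp
  whiskerRight_actionHomLeft Z φ P := by simp
  associator_actionHom X Y Z P := by simp
  leftUnitor_actionHom Z P := by simp
  rightUnitor_actionHom Z P := by simp

end EnvObj

/-- The enveloping actegory of a `V`-graded category. -/
abbrev GradedCat.enveloping (C : GradedCat V) : Actegory V where
  carrier := EnvObj C

end Enveloping

/-! ### Functoriality of the enveloping actegory, and the embedding of `C`. -/

section Enveloping

variable {V : Type u} [SmallCategory.{u} V] [MonoidalCategory V]

namespace EnvObj

variable {C D : GradedCat V}

/-- The morphism `X · A ⟶ X · B` induced by a morphism `A ⟶ B` of the underlying category. -/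
def ofBase (X : V) {A B : C.Obj} (p : C.Hom (𝟙_ V) A B) :
    (⟨X, A⟩ : EnvObj C) ⟶ ⟨X, B⟩ :=
  homMk (P := ⟨X, A⟩) (Q := ⟨X, B⟩) (ρ_ X).inv p

@[simp]
theorem ofBase_comp_homMk {X : V} {A A' : C.Obj} {Q : EnvObj C} {W : V}
    (p : C.Hom (𝟙_ V) A A') (f : X ⟶ Q.grade ⊗ W) (g : C.Hom W A' Q.base) :
    ofBase X p ≫ homMk (P := ⟨X, A'⟩) f g = homMk (P := ⟨X, A⟩) f (C.pre g p) := by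
  rw [ofBase, homMk_comp, GradedCat.pre, homMk_slide]
  congr 1
  simp

@[simp]
theorem homMk_comp_ofBase {P : EnvObj C} {Y : V} {B B' : C.Obj} {W : V}
    (f : P.grade ⟶ Y ⊗ W) (g : C.Hom W P.base B) (p : C.Hom (𝟙_ V) B B') :
    homMk (Q := ⟨Y, B⟩) f g ≫ ofBase Y p = homMk (Q := ⟨Y, B'⟩) f (C.post p g) := by
  rw [ofBase, homMk_comp, GradedCat.post, homMk_slide]
  congr 1
  simp

theorem ofBase_comp (X : V) {A A' A'' : C.Obj} (p : C.Hom (𝟙_ V) A A')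
    (q : C.Hom (𝟙_ V) A' A'') : ofBase X p ≫ ofBase X q = ofBase X (C.post q p) :=
  homMk_comp_ofBase _ _ _

@[simp]
theorem whisker_ofBase (Z X : V) {A B : C.Obj} (p : C.Hom (𝟙_ V) A B) :
    whisker Z (ofBase X p) = ofBase (Z ⊗ X) p := by
  rw [ofBase, whisker_homMk, ofBase]
  congr 1
  simp

/-- The functor between enveloping actegories induced by a graded functor. -/
def mapFunctor (F : GradedFunctor C D) : EnvObj C ⥤ EnvObj D where
  obj P := ⟨P.grade, F.obj P.base⟩
  map {P Q} p := EnvHom.lift (P := P) (Q := Q)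
    (fun {W} f g => homMk (P := ⟨P.grade, F.obj P.base⟩) (Q := ⟨Q.grade, F.obj Q.base⟩)
      f (F.map g))
    (fun f α g => by rw [F.map_reindex, homMk_slide]) p
  map_id P := by
    change homMk _ _ = homMk _ _
    rw [F.map_iden]
  map_comp p q := by
    induction p using hom_ind with | h f g => ?_
    induction q using hom_ind with | h f' g' => ?_
    change homMk _ _ = homMk _ _ ≫ homMk _ _
    rw [F.map_comp, homMk_comp]

@[simp]
theorem mapFunctor_map_homMk (F : GradedFunctor C D) {P Q : EnvObj C} {W : V}
    (f : P.grade ⟶ Q.grade ⊗ W) (g : C.Hom W P.base Q.base) :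
    (mapFunctor F).map (homMk f g) =
      homMk (P := ⟨P.grade, F.obj P.base⟩) (Q := ⟨Q.grade, F.obj Q.base⟩) f (F.map g) :=
  rfl

@[simp]
theorem mapFunctor_map_ofGrade (F : GradedFunctor C D) (A : C.Obj) {X Y : V} (φ : X ⟶ Y) :
    (mapFunctor F).map (ofGrade A φ) = ofGrade (F.obj A) φ := by
  rw [ofGrade, mapFunctor_map_homMk, F.map_iden]
  rfl

theorem mapFunctor_map_whisker (F : GradedFunctor C D) (Z : V) {P Q : EnvObj C} (p : P ⟶ Q) :
    (mapFunctor F).map (whisker Z p) = whisker Z ((mapFunctor F).map p) := by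
  induction p using hom_ind with | h f g => ?_
  rfl

/-- The induced functor leaves grades untouched, so it commutes strictly with the action and the
comparison morphisms can be identities. -/
instance mapFunctorLax (F : GradedFunctor C D) : (mapFunctor F).LaxLeftLinear V where
  μₗ X P := 𝟙 (⟨X ⊗ P.grade, F.obj P.base⟩ : EnvObj D)
  μₗ_naturality_left φ P :=
    (Category.comp_id _).trans ((mapFunctor_map_ofGrade F _ _).symm.trans
      (Category.id_comp _).symm)
  μₗ_naturality_right Z _ _ p :=
    (Category.comp_id _).trans ((mapFunctor_map_whisker F Z p).symm.trans
      (Category.id_comp _).symm)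
  μₗ_associativity Y Z P := by
    refine (Category.id_comp _).trans ((mapFunctor_map_ofGrade F _ _).trans ?_)
    change _ = ofGrade (F.obj P.base) (α_ Y Z P.grade).hom ≫
      whisker Y (𝟙 (⟨Z ⊗ P.grade, F.obj P.base⟩ : EnvObj D)) ≫
        𝟙 (⟨Y ⊗ Z ⊗ P.grade, F.obj P.base⟩ : EnvObj D)
    rw [whisker_id, Category.comp_id, Category.comp_id]
  μₗ_unitality P := by
    refine Eq.trans ?_ (Category.id_comp _).symm
    exact (mapFunctor_map_ofGrade F _ _).symm

theorem mapFunctor_μₗ (F : GradedFunctor C D) (X : V) (P : EnvObj C) :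
    μₗ (mapFunctor F) X P = 𝟙 (⟨X ⊗ P.grade, F.obj P.base⟩ : EnvObj D) :=
  rfl

/-- The natural transformation between functors on enveloping actegories induced by a
graded-natural transformation. -/
def mapNatTrans {F G : GradedFunctor C D} (σ : GradedTrans F G) :
    mapFunctor F ⟶ mapFunctor G where
  app P := ofBase P.grade (σ.app P.base)
  naturality P Q p := by
    induction p using hom_ind with | h f g => ?_
    change homMk _ _ ≫ ofBase _ _ = ofBase _ _ ≫ homMk _ _
    rw [homMk_comp_ofBase, σ.naturality, ofBase_comp_homMk]

end EnvObj

/-- The strong morphism of enveloping actegories induced by a graded functor. -/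
def GradedFunctor.enveloping {C D : GradedCat V} (F : GradedFunctor C D) :
    StrongMorphism C.enveloping D.enveloping where
  functor := EnvObj.mapFunctor F
  lax := EnvObj.mapFunctorLax F
  isIso X P := by
    rw [EnvObj.mapFunctor_μₗ]
    exact IsIso.id (⟨X ⊗ P.grade, F.obj P.base⟩ : EnvObj D)

/-- The 2-cell of enveloping actegories induced by a graded-natural transformation. -/
def GradedTrans.enveloping {C D : GradedCat V} {F G : GradedFunctor C D} (σ : GradedTrans F G) :
    ActTrans F.enveloping G.enveloping where
  nat := EnvObj.mapNatTrans σ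
  linear X P := by
    exact (Category.comp_id _).trans ((EnvObj.whisker_ofBase X P.grade (σ.app P.base)).trans
      (Category.id_comp _).symm)

/-- An isomorphism of strong morphisms from a compatible natural isomorphism. -/
@[simps]
def ActTrans.mkIso {C D : Actegory V} {F G : StrongMorphism C D} (e : F.functor ≅ G.functor)
    (linear : ∀ (X : V) (A : C.carrier),
      X ⊴ₗ e.hom.app A ≫ μₗ G.functor X A = μₗ F.functor X A ≫ e.hom.app (X ⊙ₗ A)) :
    F ≅ G where
  hom := ActTrans.mk e.hom linear
  inv := ActTrans.mk e.inv (fun X A => by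
    rw [← cancel_epi (X ⊴ₗ e.hom.app A), ← Category.assoc, ← actionHomRight_comp,
      reassoc_of% linear X A]
    simp)
  hom_inv_id := ActTrans.ext e.hom_inv_id
  inv_hom_id := ActTrans.ext e.inv_hom_id

/-- The enveloping actegory of an identity. -/
def envelopingMapId (C : GradedCat V) :
    (GradedFunctor.id C).enveloping ≅ StrongMorphism.id C.enveloping :=
  ActTrans.mkIso
    (F := (GradedFunctor.id C).enveloping) (G := StrongMorphism.id C.enveloping)
    (NatIso.ofComponents (fun P => Iso.refl P) (fun {P Q} p => by
      induction p using EnvObj.hom_ind with | h f g => ?_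
      exact (Category.comp_id _).trans (Category.id_comp _).symm))
    (fun X P => by
      change EnvObj.whisker X (𝟙 _) ≫ 𝟙 _ = 𝟙 _ ≫ 𝟙 _
      rw [EnvObj.whisker_id])

/-- The enveloping actegory of a composite. -/
def envelopingMapComp {C D E : GradedCat V} (F : GradedFunctor C D) (G : GradedFunctor D E) :
    (F.comp G).enveloping ≅ F.enveloping.comp G.enveloping :=
  ActTrans.mkIso
    (F := (F.comp G).enveloping) (G := F.enveloping.comp G.enveloping)
    (NatIso.ofComponents (fun P => Iso.refl _) (fun {P Q} p => by
      induction p using EnvObj.hom_ind with | h f g => ?_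
      exact (Category.comp_id _).trans (Category.id_comp _).symm))
    (fun X P => by
      have h (Q : EnvObj D) (K : EnvObj D ⥤ EnvObj E) (w : K.obj Q ⟶ K.obj Q) (hw : w = 𝟙 _) :
          w ≫ 𝟙 _ ≫ K.map (𝟙 Q) = 𝟙 _ ≫ 𝟙 _ := by simp [hw]
      exact h ⟨X ⊗ P.grade, F.obj P.base⟩ (EnvObj.mapFunctor G) _
        (EnvObj.whisker_id X (⟨P.grade, G.obj (F.obj P.base)⟩ : EnvObj E)))

variable (V)

/-- The pseudofunctor that sends a graded category to its enveloping actegory. -/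
def gradedToAct : Pseudofunctor (GradedCat V) (Actegory V) where
  obj C := C.enveloping
  map F := GradedFunctor.enveloping F
  map₂ σ := GradedTrans.enveloping σ
  map₂_id {C D} F := ActTrans.ext (NatTrans.ext (funext fun P => rfl))
  map₂_comp σ τ := ActTrans.ext (NatTrans.ext (funext fun P =>
    (EnvObj.ofBase_comp _ _ _).symm))
  mapId C := envelopingMapId C
  mapComp F G := envelopingMapComp F G
  map₂_whisker_left {_ _ D} F G H σ := ActTrans.ext (NatTrans.ext (funext fun P =>
    eq_id_comp_comp_id _))
  map₂_whisker_right σ H := ActTrans.ext (NatTrans.ext (funext fun P =>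
    eq_id_comp_comp_id _))
  map₂_associator {_ _ D E} F G H := ActTrans.ext (NatTrans.ext (funext fun P =>
    have h (Q : EnvObj D) (K : EnvObj D ⥤ EnvObj E) :
        𝟙 (K.obj Q) = 𝟙 _ ≫ K.map (𝟙 Q) ≫ 𝟙 _ ≫ 𝟙 _ ≫ 𝟙 _ := by simp
    h ⟨P.grade, G.obj (F.obj P.base)⟩ (EnvObj.mapFunctor H)))
  map₂_left_unitor {C D} F := ActTrans.ext (NatTrans.ext (funext fun P =>
    have h (Q : EnvObj C) (K : EnvObj C ⥤ EnvObj D) :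
        𝟙 (K.obj Q) = 𝟙 _ ≫ K.map (𝟙 Q) ≫ 𝟙 _ := by simp
    h P (EnvObj.mapFunctor F)))
  map₂_right_unitor {_ D} F := ActTrans.ext (NatTrans.ext (funext fun P =>
    have h (R : EnvObj D) : 𝟙 R = 𝟙 _ ≫ 𝟙 _ ≫ 𝟙 _ := by simp
    h ⟨P.grade, F.obj P.base⟩))

variable {V}

/-- The embedding of a graded category into its enveloping actegory. -/
def GradedCat.envelopingUnit (C : GradedCat V) : GradedFunctor C C.enveloping.toGraded where
  obj A := ⟨𝟙_ V, A⟩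
  -- A morphism `(X ⊗ I) · A ⟶ I · B` with middle grade `W = X`; its `V`-component is the structural
  -- isomorphism `X ⊗ I ≅ I ⊗ X`.
  map {X A B} g := EnvObj.homMk (P := ⟨X ⊗ 𝟙_ V, A⟩) (Q := ⟨𝟙_ V, B⟩)
    ((ρ_ X).hom ≫ (λ_ X).inv) g
  map_reindex α A B g := by
    change _ = EnvObj.ofGrade A (α ▷ 𝟙_ V) ≫ EnvObj.homMk _ _
    rw [EnvObj.homMk_slide, EnvObj.ofGrade_comp_homMk]
    congr 1
    simp
  map_comp {X Y A B B'} g f := by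
    change _ = EnvObj.ofGrade A (α_ Y X (𝟙_ V)).hom ≫
      EnvObj.whisker Y (EnvObj.homMk (P := ⟨X ⊗ 𝟙_ V, A⟩) (Q := ⟨𝟙_ V, B⟩) _ f) ≫
        EnvObj.homMk (P := ⟨Y ⊗ 𝟙_ V, B⟩) (Q := ⟨𝟙_ V, B'⟩) _ g
    rw [EnvObj.whisker_homMk, EnvObj.homMk_comp, EnvObj.ofGrade_comp_homMk]
    congr 1
    simp
  map_iden A := by
    change EnvObj.homMk _ _ = EnvObj.ofGrade _ _
    rw [EnvObj.ofGrade]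
    congr 1
    simp [unitors_equal, unitors_inv_equal]

end Enveloping

/-! ### The unit: pseudonaturality and full faithfulness. -/

section Enveloping

variable {V : Type u} [SmallCategory.{u} V] [MonoidalCategory V]

/-- The right-hand side is the form that `ActTrans.toGraded` gives to a component of an induced
2-cell, so this equation is the naturality of the unit with respect to 2-cells. -/
theorem EnvObj.envelopingUnit_map_underlying {C : GradedCat V} {A B : C.Obj}
    (p : C.Hom (𝟙_ V) A B) :
    C.envelopingUnit.map p =
      EnvObj.ofGrade A (λ_ (𝟙_ V)).hom ≫ EnvObj.ofBase (𝟙_ V) p := by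
  rw [EnvObj.ofBase, EnvObj.ofGrade_comp_homMk]
  change EnvObj.homMk _ _ = _
  rw [unitors_equal, unitors_inv_equal]

/-- The embeddings into enveloping actegories commute with the functors induced by a graded
functor. -/
def envelopingUnitNaturality {C D : GradedCat V} (F : GradedFunctor C D) :
    F.comp D.envelopingUnit ≅ C.envelopingUnit.comp F.enveloping.toGraded where
  hom := GradedTrans.mk (fun A => D.enveloping.toGraded.iden ⟨𝟙_ V, F.obj A⟩) (fun {X A B} f => by
    refine (GradedCat.post_iden _).trans (Eq.trans ?_ (GradedCat.pre_iden _).symm)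
    exact (Category.id_comp _).symm)
  inv := GradedTrans.mk (fun A => D.enveloping.toGraded.iden ⟨𝟙_ V, F.obj A⟩) (fun {X A B} f => by
    refine (GradedCat.post_iden _).trans (Eq.trans ?_ (GradedCat.pre_iden _).symm)
    exact Category.id_comp _)
  hom_inv_id := GradedTrans.ext (funext fun A =>
    GradedCat.post_iden (C := D.enveloping.toGraded) _)
  inv_hom_id := GradedTrans.ext (funext fun A =>
    GradedCat.post_iden (C := D.enveloping.toGraded) _)

variable (V)

/-- The embeddings into enveloping actegories form a pseudonatural transformation. -/
def envelopingUnitTrans : Pseudofunctor.StrongTrans (Pseudofunctor.id (GradedCat V))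
    ((gradedToAct V).comp (actToGraded V)) where
  app C := C.envelopingUnit
  naturality F := envelopingUnitNaturality F
  naturality_naturality {C D F G} σ := GradedTrans.ext (funext fun A => by
    refine (GradedCat.post_iden (C := D.enveloping.toGraded) _).trans
      (Eq.trans ?_ (GradedCat.post_self_iden (C := D.enveloping.toGraded) _).symm)
    exact EnvObj.envelopingUnit_map_underlying (GradedTrans.app σ A))
  naturality_id C := GradedTrans.ext (funext fun A => by
    let P : EnvObj C := ⟨𝟙_ V, A⟩
    let T := C.enveloping.toGraded
    -- All factors are identities of `P`; `w` stands for the image under `E` of an identity, the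
    -- only one that needs an argument.
    have h (w : T.Hom (𝟙_ V) P P) (hw : w = T.iden P) :
        T.post (T.post (T.iden P) ((λₗ[V] P).hom ≫ 𝟙 P)) (T.iden P) =
        T.post (T.post (T.iden P) (T.iden P)) w := by
      rw [hw, Category.comp_id]
    exact h _ (C.envelopingUnit.map_iden A))
  naturality_comp {C D E} F G := GradedTrans.ext (funext fun A => by
    let P : EnvObj E := ⟨𝟙_ V, G.obj (F.obj A)⟩
    let T := E.enveloping.toGraded
    have h (w₁ w₂ : T.Hom (𝟙_ V) P P) (h₁ : w₁ = T.iden P) (h₂ : w₂ = T.iden P) :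
        T.post (T.post (T.iden P) ((λₗ[V] P).hom ≫ 𝟙 P)) (T.iden P) =
        T.post (T.post (T.post (T.post (T.post (T.iden P) w₂) (T.iden P)) (T.iden P)) (T.iden P))
          w₁ := by
      rw [h₁, h₂, Category.comp_id]
      simp only [GradedCat.post_iden]
      exact GradedCat.post_iden _
    exact h _ _ (E.envelopingUnit.map_iden _) (G.enveloping.toGraded.map_iden ⟨𝟙_ V, F.obj A⟩))

variable {V}

/-- Co-Yoneda: since `V(X ⊗ I, I ⊗ W) ≅ V(X, W)`, the coend over `W` reduces to `C(X, A; B)`. The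
inverse reindexes `g` along the morphism `X ⟶ W` that corresponds to `f`. -/
theorem GradedCat.envelopingUnit_fullyFaithful (C : GradedCat V) :
    C.envelopingUnit.FullyFaithful := by
  intro X A B
  let inv : ((⟨X ⊗ 𝟙_ V, A⟩ : EnvObj C) ⟶ ⟨𝟙_ V, B⟩) → C.Hom X A B :=
    EnvHom.lift (P := ⟨X ⊗ 𝟙_ V, A⟩) (Q := ⟨𝟙_ V, B⟩)
      (fun {W} f g => C.reindex ((ρ_ X).inv ≫ f ≫ (λ_ W).hom) g)
      (fun f α g => by
        rw [C.reindex_reindex]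
        congr 1
        simp)
  have hinv {W : V} (f : X ⊗ 𝟙_ V ⟶ 𝟙_ V ⊗ W) (g : C.Hom W A B) :
      inv (EnvObj.homMk (P := ⟨X ⊗ 𝟙_ V, A⟩) (Q := ⟨𝟙_ V, B⟩) f g) =
        C.reindex ((ρ_ X).inv ≫ f ≫ (λ_ W).hom) g := rfl
  refine Function.bijective_iff_has_inverse.mpr ⟨inv, fun g => ?_, fun p => ?_⟩
  · refine (hinv _ g).trans ?_
    simp [C.reindex_id]
  · refine EnvObj.hom_ind (P := ⟨X ⊗ 𝟙_ V, A⟩) (Q := ⟨𝟙_ V, B⟩)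
      (motive := fun p => C.envelopingUnit.map (inv p) = p) (fun {W} f g => ?_) p
    -- The reindexing produced by `inv` slides back into the `V`-component and restores `f`.
    refine (congrArg C.envelopingUnit.map (hinv f g)).trans ((EnvObj.homMk_slide _ _ _).trans ?_)
    congr 1
    change _ ≫ 𝟙_ V ◁ _ = _
    rw [id_whiskerLeft]
    simp

theorem GradedCat.envelopingUnit_injective (C : GradedCat V) :
    Function.Injective C.envelopingUnit.obj :=
  fun _ _ h => congrArg EnvObj.base h

/-! ### Copowers in actegories, and the biadjunction data with copowers. -/

/-- In the graded category of an actegory, a graded morphism is a copower if and only if it is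
invertible. -/
theorem Actegory.isCopower_iff_isIso (D : Actegory V) {X : V} {A P : D.carrier}
    (υ : X ⊙ₗ A ⟶ P) : GradedCat.IsCopower (C := D.toGraded) (X := X) υ ↔ IsIso υ := by
  constructor
  · intro h
    -- Grade `Y = I` suffices: there, up to unitors, composition with `υ` is ordinary
    -- precomposition, and its bijectivity for all `B` makes `υ` invertible by the Yoneda argument.
    have comp_eq {B : D.carrier} (f : P ⟶ B) :
        D.toGraded.comp (X := X) (Y := 𝟙_ V) ((λₗ P).hom ≫ f) υ =
          (λ_ X).hom ⊵ₗ A ≫ υ ≫ f := by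
      change (αₗ (𝟙_ V) X A).hom ≫ 𝟙_ V ⊴ₗ υ ≫ (λₗ P).hom ≫ f = _
      simp
    have cancel {B : D.carrier} {f g : P ⟶ B} (hfg : υ ≫ f = υ ≫ g) : f = g := by
      rw [← cancel_epi (λₗ[V] P).hom]
      apply (h B (𝟙_ V)).1
      change D.toGraded.comp _ _ = D.toGraded.comp _ _
      rw [comp_eq, comp_eq, hfg]
    obtain ⟨s, hs⟩ := (h (X ⊙ₗ A : D.carrier) (𝟙_ V)).2 ((λ_ X).hom ⊵ₗ A)
    have hs' : υ ≫ (λₗ P).inv ≫ s = 𝟙 _ := by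
      rw [← cancel_epi ((λ_ X).hom ⊵ₗ A), ← comp_eq, Iso.hom_inv_id_assoc, Category.comp_id]
      exact hs
    exact ⟨(λₗ P).inv ≫ s, hs', cancel (by
      rw [Category.assoc, reassoc_of% hs', Category.comp_id])⟩
  -- Conversely, composition with `υ` is precomposition with the isomorphism `(αₗ Y X A).hom ≫ Y ⊴ₗ
  -- υ`.
  · intro _ B Y
    refine Function.bijective_iff_has_inverse.mpr
      ⟨fun f => inv (Y ⊴ₗ υ) ≫ (αₗ Y X A).inv ≫ f, fun f => ?_, fun f => ?_⟩
    · change inv (Y ⊴ₗ υ) ≫ (αₗ Y X A).inv ≫ (αₗ Y X A).hom ≫ Y ⊴ₗ υ ≫ f = f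
      simp
    · change (αₗ Y X A).hom ≫ Y ⊴ₗ υ ≫ inv (Y ⊴ₗ υ) ≫ (αₗ Y X A).inv ≫ f = f
      simp

/-- The graded category with copowers of an actegory. -/
def Actegory.toCopowerGraded (D : Actegory V) : CopowerGradedCat V where
  toGradedCat := D.toGraded
  hasCopowers X A := ⟨X ⊙ₗ A, 𝟙 _, (D.isCopower_iff_isIso _).mpr inferInstance⟩

theorem StrongMorphism.preservesCopowers {C D : Actegory V} (F : StrongMorphism C D) :
    F.toGraded.PreservesCopowers := by
  intro X A P υ h
  rw [C.isCopower_iff_isIso] at h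
  exact (D.isCopower_iff_isIso _).mpr
    (inferInstance : IsIso (μₗ F.functor X A ≫ F.functor.map υ))

/-- The copower-preserving graded functor of a strong morphism. -/
def StrongMorphism.toCopowerGraded {C D : Actegory V} (F : StrongMorphism C D) :
    CopowerFunctor C.toCopowerGraded D.toCopowerGraded where
  toGradedFunctor := F.toGraded
  preservesCopowers := F.preservesCopowers

/-- An isomorphism of copower-preserving functors from one of the graded functors. -/
@[simps]
def CopowerFunctor.isoMk {C D : CopowerGradedCat V} {F G : CopowerFunctor C D}
    (e : F.toGradedFunctor ≅ G.toGradedFunctor) : F ≅ G where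
  hom := e.hom
  inv := e.inv
  hom_inv_id := e.hom_inv_id
  inv_hom_id := e.inv_hom_id

variable (V)

/-- The 2-functor from actegories to graded categories with copowers. -/
def actToCopowerGraded : Pseudofunctor (Actegory V) (CopowerGradedCat V) where
  obj C := C.toCopowerGraded
  map F := StrongMorphism.toCopowerGraded F
  map₂ σ := (ActTrans.toGraded σ : GradedTrans _ _)
  map₂_id F := (actToGraded V).map₂_id F
  map₂_comp σ τ := (actToGraded V).map₂_comp σ τ
  mapId C := CopowerFunctor.isoMk (F := (StrongMorphism.id C).toCopowerGraded)
    (G := CopowerFunctor.id C.toCopowerGraded) ((actToGraded V).mapId C)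
  mapComp F G := CopowerFunctor.isoMk (F := (F.comp G).toCopowerGraded)
    (G := F.toCopowerGraded.comp G.toCopowerGraded) ((actToGraded V).mapComp F G)
  map₂_whisker_left F _ _ σ := (actToGraded V).map₂_whisker_left F σ
  map₂_whisker_right σ H := (actToGraded V).map₂_whisker_right σ H
  map₂_associator F G H := (actToGraded V).map₂_associator F G H
  map₂_left_unitor F := (actToGraded V).map₂_left_unitor F
  map₂_right_unitor F := (actToGraded V).map₂_right_unitor F

/-- The free completion of graded categories under copowers. -/
def gradedToCopower : Pseudofunctor (GradedCat V) (CopowerGradedCat V) :=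
  (gradedToAct V).comp (actToCopowerGraded V)

/-- The embeddings into free completions under copowers form a pseudonatural transformation. -/
def copowerUnitTrans : Pseudofunctor.StrongTrans (Pseudofunctor.id (GradedCat V))
    ((gradedToCopower V).comp (forgetCopowers V)) where
  app C := C.envelopingUnit
  naturality F := envelopingUnitNaturality F
  naturality_naturality σ := (envelopingUnitTrans V).naturality_naturality σ
  naturality_id C := by
    refine Eq.trans ?_ ((envelopingUnitTrans V).naturality_id C)
    congr 2
    -- Composing with the forgetful 2-functor only adds an identity cell; without it the axiom is
    -- the one for actegories.
    exact Category.comp_id (((gradedToAct V).comp (actToGraded V)).mapId C).hom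
  naturality_comp F G := by
    refine Eq.trans ?_ ((envelopingUnitTrans V).naturality_comp F G)
    congr 2
    exact Category.comp_id (((gradedToAct V).comp (actToGraded V)).mapComp F G).hom

end Enveloping

/-! ### Calculus of copowers in a graded category. -/

section Copowers

variable {V : Type u} [SmallCategory.{u} V] [MonoidalCategory V]

namespace GradedCat

variable {C : GradedCat V}

theorem assoc_inv {X Y Z : V} {A B B' B'' : C.Obj} (h : C.Hom Z B' B'') (g : C.Hom Y B B')
    (f : C.Hom X A B) : C.comp h (C.comp g f) =
      C.reindex (α_ Z Y X).inv (C.comp (C.comp h g) f) := by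
  rw [C.assoc, C.reindex_reindex, Iso.inv_hom_id, C.reindex_id]

theorem post_comp {X Y : V} {A B B' B'' : C.Obj} (q : C.Hom (𝟙_ V) B' B'') (g : C.Hom Y B B')
    (f : C.Hom X A B) : C.comp (C.post q g) f = C.post q (C.comp g f) := by
  simp only [post, comp_reindex_left, C.assoc, C.reindex_reindex]
  congr 1
  monoidal

theorem comp_pre {X Y : V} {A' A B B' : C.Obj} (g : C.Hom Y B B') (f : C.Hom X A B)
    (p : C.Hom (𝟙_ V) A' A) : C.comp g (C.pre f p) = C.pre (C.comp g f) p := by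
  simp only [pre, comp_reindex_right, C.assoc, C.reindex_reindex]
  congr 1
  monoidal

theorem pre_comp {X Y : V} {A B B' B'' : C.Obj} (g : C.Hom Y B' B'') (q : C.Hom (𝟙_ V) B B')
    (f : C.Hom X A B) : C.comp (C.pre g q) f = C.comp g (C.post q f) := by
  simp only [post, pre, comp_reindex_right, comp_reindex_left, C.assoc, C.reindex_reindex]
  congr 1
  monoidal

theorem post_reindex {X Y : V} (α : Y ⟶ X) {A B B' : C.Obj} (q : C.Hom (𝟙_ V) B B')
    (f : C.Hom X A B) : C.post q (C.reindex α f) = C.reindex α (C.post q f) := by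
  simp only [post, comp_reindex_right, C.reindex_reindex]
  congr 1
  simp

theorem pre_reindex {X Y : V} (α : Y ⟶ X) {A' A B : C.Obj} (f : C.Hom X A B)
    (p : C.Hom (𝟙_ V) A' A) : C.pre (C.reindex α f) p = C.reindex α (C.pre f p) := by
  simp only [pre, comp_reindex_left, C.reindex_reindex]
  congr 1
  simp

theorem comp_eq_reindex_post {X : V} {A B B' : C.Obj} (q : C.Hom (𝟙_ V) B B')
    (f : C.Hom X A B) : C.comp q f = C.reindex (λ_ X).hom (C.post q f) := by
  rw [post, C.reindex_reindex, Iso.hom_inv_id, C.reindex_id]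

/-- A morphism of the underlying ordinary category is invertible. -/
def IsInvertible {A B : C.Obj} (p : C.Hom (𝟙_ V) A B) : Prop :=
  ∃ q : C.Hom (𝟙_ V) B A, C.post q p = C.iden A ∧ C.post p q = C.iden B

namespace IsCopower

variable {X : V} {A P : C.Obj} {υ : C.Hom X A P}

theorem hom_ext (h : IsCopower υ) {Y : V} {B : C.Obj} {f g : C.Hom Y P B}
    (w : C.comp f υ = C.comp g υ) : f = g :=
  (h B Y).1 w

theorem hom_ext_post (h : IsCopower υ) {B : C.Obj} {f g : C.Hom (𝟙_ V) P B}
    (w : C.post f υ = C.post g υ) :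
    f = g :=
  h.hom_ext (by rw [comp_eq_reindex_post, w, comp_eq_reindex_post])

/-- The graded morphism out of a copower that corresponds to a given one. -/
noncomputable def desc (h : IsCopower υ) {Y : V} {B : C.Obj} (f : C.Hom (Y ⊗ X) A B) :
    C.Hom Y P B :=
  Classical.choose ((h B Y).2 f)

@[simp]
theorem comp_desc (h : IsCopower υ) {Y : V} {B : C.Obj} (f : C.Hom (Y ⊗ X) A B) :
    C.comp (h.desc f) υ = f :=
  Classical.choose_spec ((h B Y).2 f)

/-- The morphism of the underlying category out of a copower that corresponds to a given graded
morphism. -/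
noncomputable def descPost (h : IsCopower υ) {B : C.Obj} (f : C.Hom X A B) : C.Hom (𝟙_ V) P B :=
  h.desc (C.reindex (λ_ X).hom f)

@[simp]
theorem post_descPost (h : IsCopower υ) {B : C.Obj} (f : C.Hom X A B) :
    C.post (h.descPost f) υ = f := by
  rw [post, descPost, comp_desc, C.reindex_reindex, Iso.inv_hom_id, C.reindex_id]

/-- By `pre_comp`, composition with `C.post p υ` is precomposition with `p`, a bijection, followed
by composition with `υ`. -/
theorem post (h : IsCopower υ) {P' : C.Obj} {p : C.Hom (𝟙_ V) P P'} (hp : IsInvertible p) :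
    IsCopower (C.post p υ) := by
  obtain ⟨q, hq, hq'⟩ := hp
  intro B Y
  have : (fun f : C.Hom Y P' B => C.comp f (C.post p υ)) =
      (fun f : C.Hom Y P B => C.comp f υ) ∘ (fun f : C.Hom Y P' B => C.pre f p) :=
    funext fun f => (pre_comp f p υ).symm
  rw [this]
  refine (h B Y).comp (Function.bijective_iff_has_inverse.mpr
    ⟨fun f => C.pre f q, fun f => ?_, fun f => ?_⟩)
  · simp only [pre_pre, hq', pre_iden]
  · simp only [pre_pre, hq, pre_iden]

/-- If `υ` and `υ' ∘ υ` are copowers, then so is `υ'`. -/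
theorem of_comp (h : IsCopower υ) {X' : V} {P' : C.Obj} {υ' : C.Hom X' P P'}
    (h' : IsCopower (C.comp υ' υ)) :
    IsCopower υ' := by
  intro B Y
  have hreindex : Function.Bijective
      (fun f : C.Hom (Y ⊗ X' ⊗ X) A B => C.reindex (α_ Y X' X).hom f) :=
    Function.bijective_iff_has_inverse.mpr ⟨fun f => C.reindex (α_ Y X' X).inv f,
      fun f => by simp [C.reindex_reindex, C.reindex_id],
      fun f => by simp [C.reindex_reindex, C.reindex_id]⟩
  -- Two out of three for bijections: by associativity, composing with `υ'` and then `υ` is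
  -- composing with `υ' ∘ υ` up to an invertible reindexing.
  refine ((h B (Y ⊗ X')).of_comp_iff' _).mp ?_
  have : (fun f : C.Hom (Y ⊗ X') P B => C.comp f υ) ∘ (fun f : C.Hom Y P' B => C.comp f υ') =
      (fun f => C.reindex (α_ Y X' X).hom f) ∘
        (fun f : C.Hom Y P' B => C.comp f (C.comp υ' υ)) :=
    funext fun f => C.assoc f υ' υ
  rw [this]
  exact hreindex.comp (h' B Y)

/-- A copower by the unit is invertible. -/
theorem isInvertible {A P : C.Obj} {υ : C.Hom (𝟙_ V) A P} (h : IsCopower υ) :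
    IsInvertible υ :=
  ⟨h.descPost (C.iden A), h.post_descPost _, h.hom_ext_post (by
    rw [← post_post, h.post_descPost, post_self_iden, post_iden])⟩

end IsCopower

end GradedCat

theorem GradedFunctor.map_isInvertible {C D : GradedCat V} (F : GradedFunctor C D)
    {A B : C.Obj} {p : C.Hom (𝟙_ V) A B} (hp : GradedCat.IsInvertible p) :
    GradedCat.IsInvertible (F.map p) := by
  obtain ⟨q, hq, hq'⟩ := hp
  exact ⟨F.map q, by rw [← F.map_post, hq, F.map_iden], by rw [← F.map_post, hq', F.map_iden]⟩

/-- A graded-natural transformation with invertible components is an isomorphism. -/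
theorem GradedTrans.isIso_of_isInvertible {C D : GradedCat V} {F G : GradedFunctor C D}
    (σ : F ⟶ G) (h : ∀ A, GradedCat.IsInvertible (GradedTrans.app σ A)) : IsIso σ := by
  choose s hs hs' using h
  let τ : GradedTrans G F :=
    { app := s
      naturality := fun {X A B} f => by
        have := congrArg (fun t => D.post (s B) (D.pre t (s A))) (GradedTrans.naturality σ f)
        simp only [← GradedCat.post_pre, GradedCat.post_post, hs, GradedCat.post_iden,
          GradedCat.pre_pre, hs', GradedCat.pre_iden] at this
        exact this.symm }
  exact ⟨τ, GradedTrans.ext (funext hs), GradedTrans.ext (funext hs')⟩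

namespace EnvObj

variable {C : GradedCat V}

/-- The graded morphism that exhibits `X · A` as the copower of the image of `A` by `X`. -/
def copowerHom (P : EnvObj C) :
    C.enveloping.toGraded.Hom P.grade (C.envelopingUnit.obj P.base) P :=
  ofGrade P.base (ρ_ P.grade).hom

theorem isCopower_copowerHom (P : EnvObj C) :
    GradedCat.IsCopower (C := C.enveloping.toGraded) P.copowerHom :=
  (Actegory.isCopower_iff_isIso _ _).mpr (isoOfGrade P.base (ρ_ P.grade)).isIso_hom

/-- Both sides come from unitors of `V` at `I`, where left and right unitors agree. This is what
makes an extended transformation restrict to the given one. -/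
theorem copowerHom_unit (A : C.Obj) :
    copowerHom (C.envelopingUnit.obj A) = C.enveloping.toGraded.iden _ := by
  change ofGrade A (ρ_ (𝟙_ V)).hom = ofGrade A (λ_ (𝟙_ V)).hom
  rw [unitors_equal]

/-- Since `P.copowerHom` is a copower, this equation characterises the class of `(f, g)`. It
expresses every graded morphism out of `P` through the image of `E`, the canonical copower morphisms
and reindexing. -/
theorem homMk_comp_copowerHom {Z : V} {P Q : EnvObj C} {W : V} (f : Z ⊗ P.grade ⟶ Q.grade ⊗ W)
    (g : C.Hom W P.base Q.base) :
    C.enveloping.toGraded.comp (X := P.grade) (Y := Z)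
        (homMk (P := ⟨Z ⊗ P.grade, P.base⟩) f g) P.copowerHom =
      C.enveloping.toGraded.reindex f
        (C.enveloping.toGraded.comp Q.copowerHom (C.envelopingUnit.map g)) := by
  obtain ⟨X, A⟩ := P
  obtain ⟨Y, B⟩ := Q
  change ofGrade A (α_ Z X (𝟙_ V)).hom ≫ whisker Z (ofGrade A (ρ_ X).hom) ≫
      homMk (P := ⟨Z ⊗ X, A⟩) (Q := ⟨Y, B⟩) f g =
    ofGrade A (f ▷ 𝟙_ V) ≫ ofGrade A (α_ Y W (𝟙_ V)).hom ≫
      whisker Y (homMk (P := ⟨W ⊗ 𝟙_ V, A⟩) (Q := ⟨𝟙_ V, B⟩) ((ρ_ W).hom ≫ (λ_ W).inv) g) ≫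
      ofGrade B (ρ_ Y).hom
  rw [whisker_ofGrade, whisker_homMk, homMk_comp_ofGrade]
  simp only [ofGrade_comp_homMk]
  congr 1
  simp

end EnvObj

end Copowers

/-! ### Extension of transformations and functors along the embedding. -/

section Copowers

variable {V : Type u} [SmallCategory.{u} V] [MonoidalCategory V]

/-- Every graded morphism is the canonical copower morphism followed by a morphism of the underlying
category, so a graded functor is controlled by its values on these two kinds. -/
theorem Actegory.post_id (C : Actegory V) {X : V} {A B : C.carrier} (f : X ⊙ₗ A ⟶ B) :
    C.toGraded.post (X := X) (A := A) (B := X ⊙ₗ A) ((λₗ (X ⊙ₗ A)).hom ≫ f) (𝟙 (X ⊙ₗ A)) = f := by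
  rw [Actegory.post_eq]
  simp

/-- A graded functor defined on an actegory preserves copowers as soon as it preserves the
canonical ones. -/
theorem Actegory.preservesCopowers_of_id {C : Actegory V} {D : GradedCat V}
    (G : GradedFunctor C.toGraded D)
    (h : ∀ (X : V) (A : C.carrier), GradedCat.IsCopower
      (G.map (X := X) (A := A) (B := X ⊙ₗ A) (𝟙 (X ⊙ₗ A)))) : G.PreservesCopowers := by
  intro X A P υ hυ
  have hiso : IsIso υ := (C.isCopower_iff_isIso _).mp hυ
  have hinv : GradedCat.IsInvertible (C := C.toGraded) (A := X ⊙ₗ A) (B := P)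
      ((λₗ (X ⊙ₗ A)).hom ≫ υ) := by
    refine ⟨(λₗ P).hom ≫ inv υ, ?_, ?_⟩
    · rw [Actegory.post_eq]
      simp
    · rw [Actegory.post_eq]
      simp
  -- Any copower `υ` is the canonical one followed by an invertible morphism, and `G` preserves
  -- both.
  rw [← C.post_id υ, G.map_post]
  exact (h X A).post (G.map_isInvertible hinv)

/-- Naturality at `p` can be tested after composition with `G.map υ`, as this is a copower. There
`hp` replaces `p` by `ω` and `e`, where naturality is assumed. `G'` need not preserve copowers. -/
theorem GradedTrans.naturality_of_copower {T D : GradedCat V} {G G' : GradedFunctor T D}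
    {X Y Z W : V} {A B P Q : T.Obj} {υ : T.Hom X A P} {ω : T.Hom Y B Q} {e : T.Hom W A B}
    {p : T.Hom Z P Q} {f : Z ⊗ X ⟶ Y ⊗ W} (hp : T.comp p υ = T.reindex f (T.comp ω e))
    (hυ : GradedCat.IsCopower (G.map υ)) {a : D.Hom (𝟙_ V) (G.obj A) (G'.obj A)}
    {b : D.Hom (𝟙_ V) (G.obj B) (G'.obj B)} {s : D.Hom (𝟙_ V) (G.obj P) (G'.obj P)}
    {t : D.Hom (𝟙_ V) (G.obj Q) (G'.obj Q)} (hs : D.post s (G.map υ) = D.pre (G'.map υ) a)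
    (ht : D.post t (G.map ω) = D.pre (G'.map ω) b)
    (he : D.post b (G.map e) = D.pre (G'.map e) a) :
    D.post t (G.map p) = D.pre (G'.map p) s := by
  apply hυ.hom_ext
  rw [GradedCat.post_comp, GradedCat.pre_comp, hs, GradedCat.comp_pre, ← G.map_comp,
    ← G'.map_comp, hp, G.map_reindex, G'.map_reindex, G.map_comp, G'.map_comp,
    GradedCat.post_reindex, GradedCat.pre_reindex, ← GradedCat.post_comp, ht,
    ← GradedCat.comp_pre, GradedCat.pre_comp, he]

section Extension

variable {C D : GradedCat V}

/-- A transformation between functors on the enveloping actegory is determined by its components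
at the objects of `C`, if its domain preserves copowers. -/
theorem GradedTrans.enveloping_ext {G G' : GradedFunctor C.enveloping.toGraded D}
    (hG : G.PreservesCopowers) {σ τ : GradedTrans G G'}
    (h : ∀ A : C.Obj, σ.app (C.envelopingUnit.obj A) = τ.app (C.envelopingUnit.obj A)) :
    σ = τ :=
  GradedTrans.ext (funext fun P => (hG _ P.isCopower_copowerHom).hom_ext_post (by
    rw [σ.naturality, τ.naturality, h]))

/-- The components of the extension to the enveloping actegory of a transformation defined
on `C`. -/
noncomputable def GradedTrans.extendApp {G G' : GradedFunctor C.enveloping.toGraded D}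
    (hG : G.PreservesCopowers)
    (τ : GradedTrans (C.envelopingUnit.comp G) (C.envelopingUnit.comp G')) (P : EnvObj C) :
    D.Hom (𝟙_ V) (G.obj P) (G'.obj P) :=
  (hG _ P.isCopower_copowerHom).descPost (D.pre (G'.map P.copowerHom) (τ.app P.base))

theorem GradedTrans.post_extendApp {G G' : GradedFunctor C.enveloping.toGraded D}
    (hG : G.PreservesCopowers)
    (τ : GradedTrans (C.envelopingUnit.comp G) (C.envelopingUnit.comp G')) (P : EnvObj C) :
    D.post (τ.extendApp hG P) (G.map P.copowerHom) =
      D.pre (A := G'.obj (C.envelopingUnit.obj P.base)) (G'.map P.copowerHom) (τ.app P.base) :=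
  (hG _ P.isCopower_copowerHom).post_descPost _

/-- The extension to the enveloping actegory of a transformation defined on `C`. -/
noncomputable def GradedTrans.extend {G G' : GradedFunctor C.enveloping.toGraded D}
    (hG : G.PreservesCopowers)
    (τ : GradedTrans (C.envelopingUnit.comp G) (C.envelopingUnit.comp G')) :
    GradedTrans G G' where
  app P := τ.extendApp hG P
  naturality {Z P Q} p :=
    EnvObj.hom_ind (P := ⟨Z ⊗ P.grade, P.base⟩) (Q := Q)
      (motive := fun p => D.post (τ.extendApp hG Q) (G.map (X := Z) (A := P) p) =
        D.pre (G'.map (X := Z) (A := P) p) (τ.extendApp hG P))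
      (fun f g => GradedTrans.naturality_of_copower (EnvObj.homMk_comp_copowerHom f g)
        (hG _ P.isCopower_copowerHom) (τ.post_extendApp hG P) (τ.post_extendApp hG Q)
        (τ.naturality g)) p

theorem GradedTrans.extend_app_unit {G G' : GradedFunctor C.enveloping.toGraded D}
    (hG : G.PreservesCopowers)
    (τ : GradedTrans (C.envelopingUnit.comp G) (C.envelopingUnit.comp G')) (A : C.Obj) :
    (τ.extend hG).app (C.envelopingUnit.obj A) = τ.app A := by
  apply (hG _ (EnvObj.isCopower_copowerHom (C.envelopingUnit.obj A))).hom_ext_post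
  refine (τ.post_extendApp hG (C.envelopingUnit.obj A)).trans ?_
  have h (w : C.enveloping.toGraded.Hom (𝟙_ V) (C.envelopingUnit.obj A) (C.envelopingUnit.obj A))
      (hw : w = C.enveloping.toGraded.iden _)
      (t : D.Hom (𝟙_ V) (G.obj (C.envelopingUnit.obj A)) (G'.obj (C.envelopingUnit.obj A))) :
      D.pre (G'.map w) t = D.post t (G.map w) := by
    rw [hw, G.map_iden, G'.map_iden, GradedCat.iden_pre, GradedCat.post_self_iden]
  exact h _ (EnvObj.copowerHom_unit A) (τ.app A)

variable (F : GradedFunctor C D) (hD : D.HasCopowers)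

namespace GradedFunctor

/-- The value at `X · A` of the extension of `F`: a copower of `F A` by `X`. -/
noncomputable def extendObj (P : EnvObj C) : D.Obj :=
  Classical.choose (hD P.grade (F.obj P.base))

/-- The copower morphism of `extendObj`. -/
noncomputable def extendCopower (P : EnvObj C) :
    D.Hom P.grade (F.obj P.base) (F.extendObj hD P) :=
  Classical.choose (Classical.choose_spec (hD P.grade (F.obj P.base)))

theorem isCopower_extendCopower (P : EnvObj C) : GradedCat.IsCopower (F.extendCopower hD P) :=
  Classical.choose_spec (Classical.choose_spec (hD P.grade (F.obj P.base)))

/-- The graded morphism `X , F A ⟶ Y · F B` associated with a morphism `X · A ⟶ Y · B`. -/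
noncomputable def extendAux {P Q : EnvObj C} (p : P ⟶ Q) :
    D.Hom P.grade (F.obj P.base) (F.extendObj hD Q) :=
  EnvHom.lift (P := P) (Q := Q)
    -- The value dictated by `homMk_comp_copowerHom`, with the chosen copower in place of the
    -- canonical one.
    (fun f g => D.reindex f (D.comp (F.extendCopower hD Q) (F.map g)))
    (fun f α g => by
      rw [F.map_reindex, GradedCat.comp_reindex_right, D.reindex_reindex]) p

theorem extendAux_homMk {P Q : EnvObj C} {W : V} (f : P.grade ⟶ Q.grade ⊗ W)
    (g : C.Hom W P.base Q.base) : F.extendAux hD (EnvObj.homMk f g) =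
      D.reindex f (D.comp (F.extendCopower hD Q) (F.map g)) :=
  rfl

/-- `extendAux` is the transpose of the action of `extend` on morphisms. This lemma and the next two
are the transposed functor laws for reindexing, identities and composition. -/
theorem extendAux_ofGrade_comp {X Y : V} {A : C.Obj} {Q : EnvObj C} (φ : X ⟶ Y)
    (p : (⟨Y, A⟩ : EnvObj C) ⟶ Q) : F.extendAux hD (EnvObj.ofGrade A φ ≫ p) =
      D.reindex φ (F.extendAux hD p) := by
  induction p using EnvObj.hom_ind with | h f g => ?_
  rw [EnvObj.ofGrade_comp_homMk, extendAux_homMk, extendAux_homMk, D.reindex_reindex]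

theorem extendAux_ofGrade {X Y : V} (A : C.Obj) (φ : X ⟶ Y) :
    F.extendAux hD (EnvObj.ofGrade A φ) = D.reindex φ (F.extendCopower hD ⟨Y, A⟩) := by
  rw [EnvObj.ofGrade, extendAux_homMk, F.map_iden, D.comp_iden, D.reindex_reindex]
  simp

/-- On representatives `(f, g)` and `(f', g')`, both sides are reindexings of `υ ∘ F g' ∘ F g` along
the same morphism of `V`, where `υ` is the chosen copower morphism for `R`. -/
theorem extendAux_whisker_comp (Z : V) {P Q R : EnvObj C} (q : P ⟶ Q)
    (p : (⟨Z ⊗ Q.grade, Q.base⟩ : EnvObj C) ⟶ R) :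
    F.extendAux hD (EnvObj.whisker Z q ≫ p) =
      D.comp ((F.isCopower_extendCopower hD Q).desc (F.extendAux hD p)) (F.extendAux hD q) := by
  induction q using EnvObj.hom_ind with | h f g => ?_
  rw [extendAux_homMk, GradedCat.comp_reindex_right, GradedCat.assoc_inv,
    GradedCat.IsCopower.comp_desc]
  induction p using EnvObj.hom_ind with | h f' g' => ?_
  rw [EnvObj.whisker_homMk, EnvObj.homMk_comp, extendAux_homMk, extendAux_homMk,
    GradedCat.comp_reindex_left, F.map_comp, GradedCat.assoc]
  simp only [D.reindex_reindex, Category.assoc]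

/-- The extension of `F` to the enveloping actegory. -/
noncomputable def extend : GradedFunctor C.enveloping.toGraded D where
  obj P := F.extendObj hD P
  map {Z P Q} p := (F.isCopower_extendCopower hD P).desc (Y := Z) (F.extendAux hD p)
  map_reindex {X Y} α P Q p := (F.isCopower_extendCopower hD P).hom_ext (by
    rw [GradedCat.comp_reindex_left, GradedCat.IsCopower.comp_desc,
      GradedCat.IsCopower.comp_desc]
    exact F.extendAux_ofGrade_comp hD _ _)
  map_comp {X Y P Q R} p q := (F.isCopower_extendCopower hD P).hom_ext (by
    rw [GradedCat.IsCopower.comp_desc, D.assoc, GradedCat.IsCopower.comp_desc]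
    change F.extendAux hD (EnvObj.ofGrade P.base (α_ Y X P.grade).hom ≫
      EnvObj.whisker (P := ⟨X ⊗ P.grade, P.base⟩) Y q ≫ p) = _
    rw [extendAux_ofGrade_comp, extendAux_whisker_comp])
  map_iden P := (F.isCopower_extendCopower hD P).hom_ext (by
    rw [GradedCat.IsCopower.comp_desc, D.iden_comp]
    exact F.extendAux_ofGrade hD _ _)

theorem comp_extend_map {Z : V} {P Q : EnvObj C} (p : C.enveloping.toGraded.Hom Z P Q) :
    D.comp (A := F.obj P.base) (B := F.extendObj hD P) ((F.extend hD).map p)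
      (F.extendCopower hD P) = F.extendAux hD p :=
  (F.isCopower_extendCopower hD P).comp_desc _

/-- It suffices to treat the canonical copower of `P` by `X`. Its image composed with the chosen
copower of `P` is the chosen copower for grade `X ⊗ P.grade`, so `IsCopower.of_comp` applies. -/
theorem extend_preservesCopowers : (F.extend hD).PreservesCopowers := by
  refine Actegory.preservesCopowers_of_id _ fun X P => ?_
  apply (F.isCopower_extendCopower hD P).of_comp
  have h : F.extendAux hD (EnvObj.ofGrade P.base (𝟙 (X ⊗ P.grade))) =
      F.extendCopower hD ⟨X ⊗ P.grade, P.base⟩ := by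
    rw [extendAux_ofGrade, D.reindex_id]
  rw [EnvObj.ofGrade_id] at h
  exact Eq.mpr (congrArg GradedCat.IsCopower ((F.comp_extend_map hD _).trans h))
    (F.isCopower_extendCopower hD _)

/-- The extension of `F` restricts to `F`. -/
noncomputable def extendRestrict : F ⟶ C.envelopingUnit.comp (F.extend hD) :=
  GradedTrans.mk (fun A => F.extendCopower hD ⟨𝟙_ V, A⟩) (fun {X A B} f => by
    refine Eq.trans ?_ (congrArg (D.reindex (ρ_ X).inv)
      (F.comp_extend_map hD (C.envelopingUnit.map f)).symm)
    refine Eq.trans ?_ (congrArg (D.reindex (ρ_ X).inv)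
      (F.extendAux_homMk hD (P := ⟨X ⊗ 𝟙_ V, A⟩) (Q := ⟨𝟙_ V, B⟩) _ f).symm)
    have h {T : D.Obj} (t : D.Hom (𝟙_ V ⊗ X) (F.obj A) T) : D.reindex (λ_ X).inv t =
        D.reindex (ρ_ X).inv (D.reindex ((ρ_ X).hom ≫ (λ_ X).inv) t) := by
      rw [D.reindex_reindex, Iso.inv_hom_id_assoc]
    exact h _)

theorem extendRestrict_isIso : IsIso (F.extendRestrict hD) :=
  GradedTrans.isIso_of_isInvertible _ fun A =>
    (F.isCopower_extendCopower hD ⟨𝟙_ V, A⟩).isInvertible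

end GradedFunctor

end Extension

variable (V)

/-- The free completion under copowers is left biadjoint to the forgetful 2-functor. -/
noncomputable def copowerLeftBiadjoint : LeftBiadjoint (forgetCopowers V) where
  L := gradedToCopower V
  unit := copowerUnitTrans V
  isEquivalence _ D :=
    { faithful := ⟨fun {G _} _ _ h => GradedTrans.enveloping_ext
        (CopowerFunctor.preservesCopowers G) (fun A =>
          congrFun (congrArg GradedTrans.app h) A)⟩
      full := ⟨fun {G _} τ => ⟨GradedTrans.extend (CopowerFunctor.preservesCopowers G) τ,
        GradedTrans.ext (funext fun A => GradedTrans.extend_app_unit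
          (CopowerFunctor.preservesCopowers G) τ A)⟩⟩
      essSurj := ⟨fun F => ⟨⟨GradedFunctor.extend F D.hasCopowers,
        GradedFunctor.extend_preservesCopowers F D.hasCopowers⟩,
        ⟨(@asIso _ _ _ _ _ (GradedFunctor.extendRestrict_isIso F D.hasCopowers)).symm⟩⟩⟩ }

end Copowers

/-! ### Strong morphisms as copower-preserving graded functors. -/

section Actegories

variable {V : Type u} [SmallCategory.{u} V] [MonoidalCategory V]

section

variable {C D : Actegory V}

theorem ActTrans.toGraded_injective {F G : StrongMorphism C D} {σ τ : ActTrans F G}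
    (h : σ.toGraded = τ.toGraded) : σ = τ :=
  ActTrans.ext (NatTrans.ext (funext fun A => (cancel_epi (λₗ[V] (F.functor.obj A)).hom).mp
    (congrFun (congrArg GradedTrans.app h) A)))

/-- The 2-cell of actegories of a graded-natural transformation. -/
def ActTrans.ofGraded {F G : StrongMorphism C D} (τ : GradedTrans F.toGraded G.toGraded) :
    ActTrans F G where
  nat :=
    { app := fun A => (λₗ[V] (F.functor.obj A)).inv ≫ τ.app A
      naturality := fun A B f => by
        -- Grade `I` gives ordinary naturality; the identity of `X ⊙ₗ A`, read as a morphism of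
        -- grade `X`, gives linearity below.
        have h := τ.naturality (X := 𝟙_ V) (A := A) ((λₗ A).hom ≫ f)
        rw [Actegory.post_eq, Actegory.pre_eq] at h
        simp only [Functor.map_comp, ← μₗ_unitality_assoc] at h
        rw [← cancel_epi (λₗ[V] (F.functor.obj A)).hom]
        simpa using h }
  linear X A := by
    have h : (μₗ F.functor X A ≫ F.functor.map (𝟙 (X ⊙ₗ A))) ≫
        (λₗ[V] (F.functor.obj (X ⊙ₗ A))).inv ≫ τ.app (X ⊙ₗ A : C.carrier) =
        X ⊴ₗ ((λₗ[V] (F.functor.obj A)).inv ≫ τ.app A) ≫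
          μₗ G.functor X A ≫ G.functor.map (𝟙 (X ⊙ₗ A)) := by
      have h := τ.naturality (X := X) (A := A) (𝟙 (X ⊙ₗ A))
      rw [Actegory.post_eq, Actegory.pre_eq] at h
      exact h
    rw [F.functor.map_id, G.functor.map_id, Category.comp_id, Category.comp_id] at h
    exact h.symm

theorem ActTrans.toGraded_ofGraded {F G : StrongMorphism C D}
    (τ : GradedTrans F.toGraded G.toGraded) : (ActTrans.ofGraded τ).toGraded = τ :=
  GradedTrans.ext (funext fun _ => Iso.hom_inv_id_assoc _ _)

/-- The functor on underlying categories of a graded functor between actegories. -/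
def GradedFunctor.underlying (G : GradedFunctor C.toGraded D.toGraded) :
    C.carrier ⥤ D.carrier where
  obj A := G.obj A
  map {A B} f := (λₗ[V] (G.obj A)).inv ≫ G.map (X := 𝟙_ V) (A := A) (B := B) ((λₗ A).hom ≫ f)
  map_id A := by
    rw [Category.comp_id]
    exact (congrArg ((λₗ[V] (G.obj A)).inv ≫ ·) (G.map_iden A)).trans (Iso.inv_hom_id _)
  map_comp {A B B'} f g := by
    have h : (λₗ[V] A).hom ≫ f ≫ g =
        C.toGraded.post (X := 𝟙_ V) (A := A) (B := B) ((λₗ B).hom ≫ g) ((λₗ A).hom ≫ f) := by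
      rw [Actegory.post_eq]
      simp
    rw [h, G.map_post, Actegory.post_eq]
    simp

/-- The canonical comparison morphism of a graded functor between actegories. -/
def GradedFunctor.comparison (G : GradedFunctor C.toGraded D.toGraded) (X : V) (A : C.carrier) :
    X ⊙ₗ G.obj A ⟶ G.obj (X ⊙ₗ A) :=
  G.map (X := X) (A := A) (B := X ⊙ₗ A) (𝟙 (X ⊙ₗ A))

/-- `Actegory.post_id` under `G`: the underlying functor and the comparison morphisms recover `G`.
Hence `toGradedOfGraded` can have identity components. -/
theorem GradedFunctor.comparison_underlying (G : GradedFunctor C.toGraded D.toGraded) {X : V}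
    {A B : C.carrier} (f : X ⊙ₗ A ⟶ B) :
    G.comparison X A ≫ G.underlying.map f = G.map (X := X) (A := A) f := by
  conv_rhs => rw [← C.post_id f]
  rw [G.map_post, Actegory.post_eq]
  rfl

theorem GradedFunctor.underlying_comparison (G : GradedFunctor C.toGraded D.toGraded) (X : V)
    {A B : C.carrier} (f : A ⟶ B) :
    X ⊴ₗ G.underlying.map f ≫ G.comparison X B = G.map (X := X) (A := A) (X ⊴ₗ f) := by
  have h : X ⊴ₗ f =
      C.toGraded.pre (X := X) (A := B) (𝟙 (X ⊙ₗ B)) ((λₗ A).hom ≫ f) := by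
    rw [Actegory.pre_eq]
    simp
  rw [h, G.map_pre, Actegory.pre_eq]
  rfl

/-- The strong morphism of a copower-preserving graded functor between actegories. -/
def StrongMorphism.ofGraded (G : GradedFunctor C.toGraded D.toGraded)
    (hG : G.PreservesCopowers) : StrongMorphism C D where
  functor := G.underlying
  lax :=
    { μₗ := G.comparison
      μₗ_naturality_left := fun {X Y} φ A => by
        refine Eq.trans ?_ (G.comparison_underlying (X := X) (A := A) (φ ⊵ₗ A)).symm
        refine (G.map_reindex φ (A := A) (B := Y ⊙ₗ A) (𝟙 (Y ⊙ₗ A))).symm.trans ?_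
        exact congrArg (G.map (X := X) (A := A) (B := Y ⊙ₗ A)) (Category.comp_id (φ ⊵ₗ A))
      μₗ_naturality_right := fun X A B f =>
        (G.underlying_comparison X f).trans (G.comparison_underlying _).symm
      μₗ_associativity := fun X Y A => by
        -- Associativity of the comparison is preservation by `G` of the composite of two canonical
        -- copower morphisms.
        refine (G.comparison_underlying (X := X ⊗ Y) (A := A) _).trans (Eq.trans ?_
          (G.map_comp (X := Y) (Y := X) (A := A) (B := Y ⊙ₗ A) (B' := X ⊙ₗ Y ⊙ₗ A)
            (𝟙 (X ⊙ₗ Y ⊙ₗ A)) (𝟙 (Y ⊙ₗ A))))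
        refine congrArg (G.map (X := X ⊗ Y) (A := A) (B := X ⊙ₗ Y ⊙ₗ A)) ?_
        change _ = (αₗ X Y A).hom ≫ X ⊴ₗ 𝟙 (Y ⊙ₗ A) ≫ 𝟙 _
        simp
      μₗ_unitality := fun A =>
        (G.map_iden A).symm.trans (G.comparison_underlying _).symm }
  -- The canonical copower morphism is an identity, so its image under `G` is a copower, that is, an
  -- isomorphism.
  isIso X A := (D.isCopower_iff_isIso _).mp (hG _ ((C.isCopower_iff_isIso _).mpr
    (inferInstance : IsIso (𝟙 (X ⊙ₗ A)))))

/-- The graded functor of the strong morphism of `G` is `G`. -/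
def StrongMorphism.toGradedOfGraded (G : GradedFunctor C.toGraded D.toGraded)
    (hG : G.PreservesCopowers) : (StrongMorphism.ofGraded G hG).toGraded ≅ G where
  hom := GradedTrans.mk (fun A => D.toGraded.iden (G.obj A)) (fun {X A B} f => by
    refine (GradedCat.post_iden _).trans (Eq.trans ?_ (GradedCat.pre_iden _).symm)
    exact G.comparison_underlying f)
  inv := GradedTrans.mk (fun A => D.toGraded.iden (G.obj A)) (fun {X A B} f => by
    refine (GradedCat.post_iden _).trans (Eq.trans ?_ (GradedCat.pre_iden _).symm)
    exact (G.comparison_underlying f).symm)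
  hom_inv_id := GradedTrans.ext (funext fun A => GradedCat.post_iden (C := D.toGraded) _)
  inv_hom_id := GradedTrans.ext (funext fun A => GradedCat.post_iden (C := D.toGraded) _)

end

variable (V)

/-- The enveloping actegory construction is left biadjoint to the canonical 2-functor from
actegories to graded categories. -/
noncomputable def actLeftBiadjoint : LeftBiadjoint (actToGraded V) where
  L := gradedToAct V
  unit := envelopingUnitTrans V
  isEquivalence C D :=
    { faithful := ⟨fun {G _} _ _ h => ActTrans.toGraded_injective (GradedTrans.enveloping_ext
        (StrongMorphism.preservesCopowers G) (fun A =>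
          congrFun (congrArg GradedTrans.app h) A))⟩
      full := ⟨fun {G _} τ => ⟨ActTrans.ofGraded
          (GradedTrans.extend (StrongMorphism.preservesCopowers G) τ),
        GradedTrans.ext (funext fun A =>
          (congrFun (congrArg GradedTrans.app (ActTrans.toGraded_ofGraded
            (GradedTrans.extend (StrongMorphism.preservesCopowers G) τ))) _).trans
          (GradedTrans.extend_app_unit (StrongMorphism.preservesCopowers G) τ A))⟩⟩
      essSurj := ⟨fun F =>
        have hD := D.toCopowerGraded.hasCopowers
        have hF : GradedFunctor.PreservesCopowers (GradedFunctor.extend F hD) :=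
          GradedFunctor.extend_preservesCopowers F hD
        have := GradedFunctor.extendRestrict_isIso F hD
        ⟨StrongMorphism.ofGraded (GradedFunctor.extend F hD) hF,
          ⟨(Bicategory.precomp D.toGraded C.envelopingUnit).mapIso
              (StrongMorphism.toGradedOfGraded (GradedFunctor.extend F hD) hF) ≪≫
            (asIso (GradedFunctor.extendRestrict F hD)).symm⟩⟩⟩ }

end Actegories

theorem mainTheorem6 (V : Type u) [SmallCategory.{u} V] [MonoidalCategory V] :
    (∃ 𝓛 : LeftBiadjoint (forgetCopowers V), ∀ C : GradedCat V,
      let C' : CopowerGradedCat V := 𝓛.L.obj C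
      let E : GradedFunctor C C'.toGradedCat := 𝓛.unit.app C
      E.FullyFaithful ∧ Function.Injective E.obj ∧
        ∀ P : C'.Obj, ∃ (X : V) (A : C.Obj) (υ : C'.Hom X (E.obj A) P),
          GradedCat.IsCopower υ) ∧
    (∃ 𝓛 : LeftBiadjoint (actToGraded V), ∀ C : GradedCat V,
      let C' : Actegory V := 𝓛.L.obj C
      let E : GradedFunctor C C'.toGraded := 𝓛.unit.app C
      E.FullyFaithful ∧ Function.Injective E.obj ∧
        ∀ P : C'.carrier, ∃ (X : V) (A : C.Obj),
          Nonempty (P ≅ (X ⊙ₗ E.obj A : C'.carrier))) := by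
  refine ⟨⟨copowerLeftBiadjoint V, fun C => ⟨C.envelopingUnit_fullyFaithful,
    C.envelopingUnit_injective, fun P => ?_⟩⟩,
    ⟨actLeftBiadjoint V, fun C => ⟨C.envelopingUnit_fullyFaithful,
    C.envelopingUnit_injective, fun P => ?_⟩⟩⟩
  · exact ⟨EnvObj.grade P, EnvObj.base P, EnvObj.copowerHom P, EnvObj.isCopower_copowerHom P⟩
  -- `X ⊙ₗ E A` is `(X ⊗ I) · A`, so the right unitor identifies it with `X · A`.
  · exact ⟨EnvObj.grade P, EnvObj.base P,
      ⟨(EnvObj.isoOfGrade (EnvObj.base P) (ρ_ (EnvObj.grade P))).symm⟩⟩
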